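/- For $k\ge 2$ and a finite simple graph $G$, let $R_k(G)$ denote the smallest integer $n$ such that every colouring of the edges of the complete graph $K_n$ with $k$ colours contains a monochromatic copy of $G$ (a not necessarily induced subgraph isomorphic to $G$, all of whose edges have the same colour), and let $P_9$ be the path on $9$ vertices. Then $$R_3(P_9)\le 17 ;$$ in particular, every colouring of the edges of $K_{17}$ with three colours contains a monochromatic $P_9$. -/

import Mathlib

/-- The edge colouring `C` of `K_n` (vertex set `Fin n`) with colour set `κ` contains a
monochromatic copy of `G i` in colour `i` for some `i`. -/
def HasMonochromaticCopy {κ : Type*} {V : κ → Type*} (G : ∀ i, SimpleGraph (V i)) {n : ℕ}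
    (C : SimpleGraph.TopEdgeLabeling (Fin n) κ) : Prop :=
  ∃ i, (G i).IsContained (C.labelGraph i)

/-- Every colouring of the edges of `K_n` with colour set `κ` contains a copy of `G i` in
colour `i` for some `i`. -/
def RamseyArrows {κ : Type*} {V : κ → Type*} (n : ℕ) (G : ∀ i, SimpleGraph (V i)) : Prop :=
  ∀ C : SimpleGraph.TopEdgeLabeling (Fin n) κ, HasMonochromaticCopy G C

/-- The multicolour Ramsey number of the family `G`: the smallest `n` such that every colouring
of the edges of `K_n` with colour set `κ` contains a copy of `G i` in colour `i` for some `i`.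
It takes values in `ℕ∞`; it is `⊤` when there is no such `n`, so that a bound by a natural
number includes the existence of such an `n`. -/
noncomputable def multicolorRamsey {κ : Type*} {V : κ → Type*} (G : ∀ i, SimpleGraph (V i)) :
    ℕ∞ :=
  ⨅ (n : ℕ) (_ : RamseyArrows n G), (n : ℕ∞)

/-- The diagonal Ramsey number `R_k(G) = R(G, …, G)` with `k` colours. -/
noncomputable def diagonalRamsey {V : Type*} (k : ℕ) (G : SimpleGraph V) : ℕ∞ :=
  multicolorRamsey (fun _ : Fin k => G)

/-! Suppose no colour of a 3-coloured `K_17` contains a path on nine vertices. The key fact is a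
stability theorem: a connected graph on m ≥ 11 vertices without such a path has at most 3m - 5
edges, and equality forces a vertex adjacent to all others (`ConnOn.exists_dominating`). For m = 17
the bound is 46. Moreover a colour with at least 45 edges is connected (`connOn_univ_of_degSum`).
Since 3 · 45 < 136, some colour has 46 edges and another has at least 45. The dominating vertex of
the first is isolated in the second, which is connected: a contradiction.

Connectedness: a disconnected colour with so many edges would leave a cut with sides between 7 and
10 without edges, so that the other two colours share at least 70 edges of a complete bipartite
graph. A bipartite graph without a nine-vertex path and without `K_{3,7}` has at most twice as many
edges as vertices (`degSum_le_of_bipartite`), and a `K_{3,7}` in one colour produces a nine-vertex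
path in one of the two (`false_of_complete_three_seven`). Hence at most 34 + 34 < 70 edges cross the
cut.

Stability: an end of a longest path can be deleted without disconnecting the graph, and by Pósa's
crossing argument one end has degree at most 3. Peeling such vertices leaves a core of 7, 6 or 5
vertices. Cores of size 7 or 6 with minimum degree 4 are Hamilton connected, and then too few edges
can be attached. A core of size 5 must be complete, and the count is tight at every later vertex,
which forces a common neighbourhood of three vertices outside a set of six.

Edges are counted through degree sums, so every edge count appears doubled. -/

/-! ### Paths with a prescribed vertex set, and crossing edges. -/

section PathsInGraphs

variable {V : Type*} [DecidableEq V] {G : SimpleGraph V}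

/-- `PathOn G K x y`: the graph `G` has a path from `x` to `y` with vertex set exactly `K`. -/
inductive PathOn (G : SimpleGraph V) : Finset V → V → V → Prop
  | single (x : V) : PathOn G {x} x x
  | cons {K : Finset V} {x y z : V} (h : PathOn G K y z) (hx : x ∉ K) (hxy : G.Adj x y) :
      PathOn G (insert x K) x z

namespace PathOn

theorem left_mem {K : Finset V} {x y : V} (h : PathOn G K x y) : x ∈ K := by
  cases h <;> simp

theorem right_mem {K : Finset V} {x y : V} (h : PathOn G K x y) : y ∈ K := by
  induction h with
  | single x => simp
  | cons h hx hxy ih => exact Finset.mem_insert_of_mem ih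

theorem append {K L : Finset V} {x y u v : V} (h : PathOn G K x y) (h' : PathOn G L u v)
    (hd : Disjoint K L) (hyu : G.Adj y u) : PathOn G (K ∪ L) x v := by
  induction h with
  | single x =>
    rw [Finset.disjoint_singleton_left] at hd
    exact cons h' hd hyu
  | cons h hx hxy ih =>
    rw [Finset.disjoint_insert_left] at hd
    rw [Finset.insert_union]
    exact cons (ih hd.2 hyu) (by simp [hx, hd.1]) hxy

theorem snoc {K : Finset V} {x y v : V} (h : PathOn G K x y) (hv : v ∉ K) (hyv : G.Adj y v) :
    PathOn G (insert v K) x v := by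
  have := h.append (single v) (by simpa using hv) hyv
  rwa [Finset.union_comm, ← Finset.insert_eq] at this

theorem symm {K : Finset V} {x y : V} (h : PathOn G K x y) : PathOn G K y x := by
  induction h with
  | single x => exact single x
  | cons h hx hxy ih => exact ih.snoc hx hxy.symm

theorem tail {K : Finset V} {x y : V} (h : PathOn G K x y) (hK : 2 ≤ K.card) :
    ∃ s, PathOn G (K.erase x) s y ∧ G.Adj x s := by
  cases h with
  | single => simp at hK
  | @cons K' _ s _ h hx hxy => exact ⟨s, by rwa [Finset.erase_insert hx], hxy⟩

theorem split {K : Finset V} {x y : V} (h : PathOn G K x y) {w : V} (hw : w ∈ K) (hwx : w ≠ x) :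
    ∃ K₁ K₂ u, PathOn G K₁ x u ∧ PathOn G K₂ w y ∧ G.Adj u w ∧ Disjoint K₁ K₂ ∧
      K₁ ∪ K₂ = K := by
  induction h with
  | single x => simp at hw; exact absurd hw hwx
  | @cons K x s y h hx hxs ih =>
    have hw' : w ∈ K := by simpa [hwx] using hw
    by_cases hws : w = s
    · subst hws
      exact ⟨{x}, K, x, single x, h, hxs, by simpa using hx, rfl⟩
    · obtain ⟨K₁, K₂, u, h₁, h₂, huw, hd, hK⟩ := ih hw' hws
      have hx' : x ∉ K₁ ∧ x ∉ K₂ := by rw [← hK] at hx; simpa using hx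
      exact ⟨insert x K₁, K₂, u, cons h₁ hx'.1 hxs, h₂, huw,
        by simp [Finset.disjoint_insert_left, hx'.2, hd], by rw [Finset.insert_union, hK]⟩

/-- If the vertices of a path lie on both sides of `S`, some edge of the path crosses. -/
theorem exists_crossing {K : Finset V} {x y : V} (h : PathOn G K x y) {S : Set V} {a b : V}
    (ha : a ∈ K) (haS : a ∈ S) (hb : b ∈ K) (hbS : b ∉ S) :
    ∃ u ∈ K, ∃ v ∈ K, G.Adj u v ∧ u ∈ S ∧ v ∉ S := by
  induction h generalizing a b with
  | single x => simp at ha hb; subst ha; subst hb; exact absurd haS hbS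
  | @cons K x s y h hx hxs ih =>
    have hs := h.left_mem
    have lift : (∃ u ∈ K, ∃ v ∈ K, G.Adj u v ∧ u ∈ S ∧ v ∉ S) →
        ∃ u ∈ insert x K, ∃ v ∈ insert x K, G.Adj u v ∧ u ∈ S ∧ v ∉ S := by
      rintro ⟨u, hu, v, hv, h⟩
      exact ⟨u, Finset.mem_insert_of_mem hu, v, Finset.mem_insert_of_mem hv, h⟩
    have hs' := Finset.mem_insert_of_mem (b := x) hs
    by_cases hxS : x ∈ S <;> by_cases hsS : s ∈ S
    · have hb' : b ∈ K := by
        rcases Finset.mem_insert.1 hb with rfl | hb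
        · exact absurd hxS hbS
        · exact hb
      exact lift (ih hs hsS hb' hbS)
    · exact ⟨x, by simp, s, hs', hxs, hxS, hsS⟩
    · exact ⟨s, hs', x, by simp, hxs.symm, hsS, hxS⟩
    · have ha' : a ∈ K := by
        rcases Finset.mem_insert.1 ha with rfl | ha
        · exact absurd haS hxS
        · exact ha
      exact lift (ih ha' haS hs hsS)

/-- Pósa's crossing argument: if the sets `A` and `B` are large, then some edge `u v` of the
path from `x` to `y` has `u ∈ B` and `v ∈ A`. -/
theorem exists_crossing_edge {K : Finset V} {x y : V} (h : PathOn G K x y) {A B S : Finset V}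
    (hA : A ⊆ K) (hxA : x ∉ A) (hB : B ⊆ K) (hyB : y ∉ B) (hBS : B ⊆ S)
    (hAS : ∀ u ∈ K, ∀ v ∈ A, G.Adj u v → u ≠ y → u ∈ S) (hc : S.card < A.card + B.card) :
    ∃ K₁ K₂ u v, PathOn G K₁ x u ∧ PathOn G K₂ v y ∧ G.Adj u v ∧ Disjoint K₁ K₂ ∧
      K₁ ∪ K₂ = K ∧ v ∈ A ∧ u ∈ B := by
  induction h generalizing A B S with
  | single x =>
    have hA0 : A = ∅ := by
      rw [Finset.eq_empty_iff_forall_notMem]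
      intro a ha
      have := hA ha
      simp at this; subst this; exact hxA ha
    have hB0 : B = ∅ := by
      rw [Finset.eq_empty_iff_forall_notMem]
      intro a ha
      have := hB ha
      simp at this; subst this; exact hyB ha
    simp [hA0, hB0] at hc
  | @cons K x s y h hx hxs ih =>
    by_cases hsx : s ∈ A ∧ x ∈ B
    · exact ⟨{x}, K, x, s, single x, h, hxs, by simpa using hx, rfl, hsx.1, hsx.2⟩
    have hxy : x ≠ y := by rintro rfl; exact hx h.right_mem
    have hA' : A.erase s ⊆ K := by
      intro a ha
      have ha' := Finset.mem_of_mem_erase ha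
      rcases Finset.mem_insert.1 (hA ha') with rfl | h'
      · exact absurd ha' hxA
      · exact h'
    have hB' : B.erase x ⊆ K := by
      intro a ha
      rcases Finset.mem_insert.1 (hB (Finset.mem_of_mem_erase ha)) with rfl | h'
      · simp at ha
      · exact h'
    -- Passing to the tail removes at most one element from `A` and `B` together, and whenever it
    -- does, `x` lies in `S`; so the strict inequality survives.
    have hcard : (S.erase x).card < (A.erase s).card + (B.erase x).card := by
      have h1 : s ∈ A → x ∈ S := fun hs => hAS x (by simp) s hs hxs hxy
      have h2 : x ∈ B → x ∈ S := fun hx => hBS hx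
      have e1 := Finset.card_erase_add_one (s := A) (a := s)
      have e2 := Finset.card_erase_add_one (s := B) (a := x)
      have e3 := Finset.card_erase_add_one (s := S) (a := x)
      have e4 := Finset.card_erase_le (s := S) (a := x)
      by_cases hs : s ∈ A
      · have hxB : x ∉ B := fun h => hsx ⟨hs, h⟩
        rw [Finset.erase_eq_of_notMem hxB]
        have := e1 hs; have := e3 (h1 hs); omega
      · rw [Finset.erase_eq_of_notMem hs]
        by_cases hxB : x ∈ B
        · have := e2 hxB; have := e3 (h2 hxB); omega
        · rw [Finset.erase_eq_of_notMem hxB]; omega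
    obtain ⟨K₁, K₂, u, v, h₁, h₂, huv, hd, hK, hv, hu⟩ :=
      ih hA' (by simp) hB' (by simp [hyB]) (Finset.erase_subset_erase x hBS)
        (fun u hu v hv huv huy => Finset.mem_erase.2 ⟨by rintro rfl; exact hx hu,
          hAS u (Finset.mem_insert_of_mem hu) v (Finset.mem_of_mem_erase hv) huv huy⟩) hcard
    have hx' : x ∉ K₁ ∧ x ∉ K₂ := by rw [← hK] at hx; simpa using hx
    exact ⟨insert x K₁, K₂, u, v, cons h₁ hx'.1 hxs, h₂, huv,
      by simp [Finset.disjoint_insert_left, hx'.2, hd], by rw [Finset.insert_union, hK],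
      Finset.mem_of_mem_erase hv, Finset.mem_of_mem_erase hu⟩

theorem mono {H : SimpleGraph V} (hGH : G ≤ H) {K : Finset V} {x y : V} (h : PathOn G K x y) :
    PathOn H K x y := by
  induction h with
  | single x => exact single x
  | cons h hx hxy ih => exact cons ih hx (hGH hxy)

theorem exists_list {K : Finset V} {x y : V} (h : PathOn G K x y) :
    ∃ l : List V, (x :: l).IsChain G.Adj ∧ (x :: l).Nodup ∧ (x :: l).toFinset = K := by
  induction h with
  | single x => exact ⟨[], by simp⟩
  | @cons K x s y h hx hxs ih =>
    obtain ⟨l, hc, hn, hK⟩ := ih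
    refine ⟨s :: l, List.isChain_cons_cons.2 ⟨hxs, hc⟩, List.nodup_cons.2 ⟨?_, hn⟩, ?_⟩
    · rw [← List.mem_toFinset, hK]; exact hx
    · rw [List.toFinset_cons, hK]

theorem of_list (x : V) (l : List V) (hc : (x :: l).IsChain G.Adj) (hn : (x :: l).Nodup) :
    ∃ y, PathOn G (x :: l).toFinset x y := by
  induction l generalizing x with
  | nil => exact ⟨x, by simpa using single x⟩
  | cons s l ih =>
    rw [List.isChain_cons_cons] at hc
    rw [List.nodup_cons] at hn
    obtain ⟨y, hy⟩ := ih s hc.2 hn.2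
    refine ⟨y, ?_⟩
    rw [List.toFinset_cons]
    exact cons hy (by rw [List.mem_toFinset]; exact hn.1) hc.1

end PathOn

/-- Every path of `G` has at most eight vertices. -/
def PathNineFree (G : SimpleGraph V) : Prop := ∀ K x y, PathOn G K x y → K.card ≤ 8

theorem PathNineFree.mono {H : SimpleGraph V} (hH : PathNineFree H) (hGH : G ≤ H) :
    PathNineFree G := fun K x y h => hH K x y (h.mono hGH)

theorem PathNineFree.length_le (hG : PathNineFree G) (l : List V) (hc : l.IsChain G.Adj)
    (hn : l.Nodup) : l.length ≤ 8 := by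
  cases l with
  | nil => simp
  | cons x l =>
    obtain ⟨y, hy⟩ := PathOn.of_list x l hc hn
    rw [← List.toFinset_card_of_nodup hn]
    exact hG _ _ _ hy

theorem pathNineFree_of_not_isContained
    (h : ¬ (SimpleGraph.pathGraph 9).IsContained G) : PathNineFree G := by
  intro K x y hK
  by_contra! h9
  obtain ⟨l, hc, hn, hl⟩ := hK.exists_list
  set p := x :: l
  have hlen : 9 ≤ p.length := by
    rw [← List.toFinset_card_of_nodup hn, hl]; exact h9
  apply h
  refine ⟨⟨⟨fun i => p[i.1]'(by omega), ?_⟩, ?_⟩⟩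
  · intro i j hij
    rw [SimpleGraph.pathGraph_adj] at hij
    rw [List.isChain_iff_getElem] at hc
    rcases hij with h' | h'
    · have := hc i.1 (by omega)
      simpa [h'] using this
    · have := hc j.1 (by omega)
      simpa [h'] using this.symm
  · intro i j hij
    have := (hn.getElem_inj_iff).1 hij
    exact Fin.ext this

end PathsInGraphs

/-! ### Degree sums, longest paths, Dirac's theorem and peeling off vertices of degree at most
three. -/

section DegreesAndConnectivity

variable {V : Type*} {G : SimpleGraph V}

open Classical in
/-- The neighbours of `v` inside `T`. -/
noncomputable def nbrsIn (G : SimpleGraph V) (T : Finset V) (v : V) : Finset V := T.filter (G.Adj v)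

theorem mem_nbrsIn {T : Finset V} {u v : V} : u ∈ nbrsIn G T v ↔ u ∈ T ∧ G.Adj v u := by
  simp [nbrsIn]

theorem nbrsIn_subset {T : Finset V} {v : V} : nbrsIn G T v ⊆ T := fun _ h => (mem_nbrsIn.1 h).1

theorem nbrsIn_mono {S T : Finset V} (h : S ⊆ T) (v : V) : nbrsIn G S v ⊆ nbrsIn G T v :=
  fun _ hu => mem_nbrsIn.2 ⟨h (mem_nbrsIn.1 hu).1, (mem_nbrsIn.1 hu).2⟩

theorem notMem_nbrsIn_self {T : Finset V} {v : V} : v ∉ nbrsIn G T v := fun h =>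
  G.loopless.irrefl _ (mem_nbrsIn.1 h).2

variable [DecidableEq V]

theorem nbrsIn_subset_erase {T : Finset V} {v : V} : nbrsIn G T v ⊆ T.erase v := fun _ h =>
  Finset.mem_erase.2 ⟨(mem_nbrsIn.1 h).2.ne', (mem_nbrsIn.1 h).1⟩

theorem card_nbrsIn_lt {T : Finset V} {v : V} (hv : v ∈ T) : (nbrsIn G T v).card + 1 ≤ T.card := by
  have := Finset.card_le_card (nbrsIn_subset_erase (G := G) (T := T) (v := v))
  have := Finset.card_erase_add_one hv
  omega

theorem nbrsIn_insert_self {T : Finset V} {v : V} : nbrsIn G (insert v T) v = nbrsIn G T v := by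
  ext u
  simp only [mem_nbrsIn, Finset.mem_insert]
  constructor
  · rintro ⟨rfl | h, h'⟩
    · exact absurd h' (G.loopless.irrefl _)
    · exact ⟨h, h'⟩
  · exact fun h => ⟨Or.inr h.1, h.2⟩

theorem card_nbrsIn_erase_add_one {T : Finset V} {u v : V} (h : G.Adj v u) (hu : u ∈ T) :
    (nbrsIn G (T.erase u) v).card + 1 = (nbrsIn G T v).card := by
  have : nbrsIn G (T.erase u) v = (nbrsIn G T v).erase u := by
    ext w; simp only [mem_nbrsIn, Finset.mem_erase]; tauto
  rw [this, Finset.card_erase_add_one (mem_nbrsIn.2 ⟨hu, h⟩)]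

theorem card_nbrsIn_erase_of_not_adj {T : Finset V} {u v : V} (h : ¬ G.Adj v u) :
    nbrsIn G (T.erase u) v = nbrsIn G T v := by
  ext w; simp only [mem_nbrsIn, Finset.mem_erase]
  constructor
  · exact fun h => ⟨h.1.2, h.2⟩
  · exact fun h' => ⟨⟨by rintro rfl; exact h h'.2, h'.1⟩, h'.2⟩

theorem card_nbrsIn_le_erase {T : Finset V} {u v : V} :
    (nbrsIn G T v).card ≤ (nbrsIn G (T.erase u) v).card + 1 := by
  by_cases hu : u ∈ T
  · by_cases h : G.Adj v u
    · exact (card_nbrsIn_erase_add_one h hu).ge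
    · rw [card_nbrsIn_erase_of_not_adj h]; omega
  · rw [Finset.erase_eq_of_notMem hu]; omega

/-- The sum of the degrees inside `T`, which is twice the number of edges inside `T`. -/
noncomputable def degSum (G : SimpleGraph V) (T : Finset V) : ℕ := ∑ v ∈ T, (nbrsIn G T v).card

theorem degSum_insert {T : Finset V} {v : V} (hv : v ∉ T) :
    degSum G (insert v T) = degSum G T + 2 * (nbrsIn G T v).card := by
  have key : ∀ u ∈ T, (nbrsIn G (insert v T) u).card =
      (nbrsIn G T u).card + if u ∈ nbrsIn G T v then 1 else 0 := by
    intro u hu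
    by_cases h : G.Adj u v
    · rw [if_pos (mem_nbrsIn.2 ⟨hu, h.symm⟩),
        ← card_nbrsIn_erase_add_one h (Finset.mem_insert_self v T), Finset.erase_insert hv]
    · rw [if_neg (fun h' => h (mem_nbrsIn.1 h').2.symm), ← card_nbrsIn_erase_of_not_adj h,
        Finset.erase_insert hv, add_zero]
  rw [degSum, Finset.sum_insert hv, nbrsIn_insert_self, Finset.sum_congr rfl key,
    Finset.sum_add_distrib, Finset.sum_ite_mem, Finset.inter_eq_right.2 nbrsIn_subset]
  simp [degSum]
  ring

theorem degSum_erase {T : Finset V} {v : V} (hv : v ∈ T) :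
    degSum G T = degSum G (T.erase v) + 2 * (nbrsIn G T v).card := by
  have := degSum_insert (G := G) (Finset.notMem_erase v T)
  rw [Finset.insert_erase hv] at this
  rw [this, ← nbrsIn_insert_self, Finset.insert_erase hv]

theorem degSum_even (G : SimpleGraph V) (T : Finset V) : Even (degSum G T) := by
  induction T using Finset.induction_on with
  | empty => simp [degSum]
  | insert v T hv ih => rw [degSum_insert hv]; exact ih.add (even_two_mul _)

theorem degSum_le (G : SimpleGraph V) (T : Finset V) : degSum G T ≤ T.card * (T.card - 1) := by
  unfold degSum
  rw [← smul_eq_mul]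
  apply Finset.sum_le_card_nsmul
  intro v hv
  have := card_nbrsIn_lt (G := G) hv
  omega

theorem degSum_union_of_no_edges {S T : Finset V} (hd : Disjoint S T)
    (h : ∀ u ∈ S, ∀ v ∈ T, ¬ G.Adj u v) : degSum G (S ∪ T) = degSum G S + degSum G T := by
  unfold degSum
  rw [Finset.sum_union hd]
  congr 1
  · refine Finset.sum_congr rfl fun u hu => congrArg _ ?_
    ext w
    simp only [mem_nbrsIn, Finset.mem_union]
    have := h u hu w
    tauto
  · refine Finset.sum_congr rfl fun u hu => congrArg _ ?_
    ext w
    simp only [mem_nbrsIn, Finset.mem_union]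
    have := fun hw => h w hw u hu
    have := G.adj_comm u w
    tauto

/-- The graph induced on `M` is connected: each nonempty proper subset of `M` has an edge
leaving it. -/
def ConnOn (G : SimpleGraph V) (M : Finset V) : Prop :=
  ∀ S ⊆ M, S.Nonempty → S ≠ M → ∃ u ∈ S, ∃ v ∈ M, v ∉ S ∧ G.Adj u v

/-- `CycOn G K x y`: a path from `x` to `y` with vertex set `K`, closed by the edge `y x`. -/
def CycOn (G : SimpleGraph V) (K : Finset V) (x y : V) : Prop := PathOn G K x y ∧ G.Adj y x

theorem CycOn.rotate {K : Finset V} {x y w : V} (h : CycOn G K x y) (hw : w ∈ K) :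
    ∃ z, CycOn G K w z := by
  by_cases hwx : w = x
  · subst hwx; exact ⟨y, h⟩
  obtain ⟨K₁, K₂, u, h₁, h₂, huw, hd, hK⟩ := h.1.split hw hwx
  refine ⟨u, ?_, huw⟩
  rw [← hK, Finset.union_comm]
  exact h₂.append h₁ hd.symm h.2

/-- A path in `T` that is not shorter than any other path in `T`. -/
theorem exists_longest_path {T : Finset V} (hT : T.Nonempty) :
    ∃ K x y, PathOn G K x y ∧ K ⊆ T ∧
      ∀ K' x' y', PathOn G K' x' y' → K' ⊆ T → K'.card ≤ K.card := by
  classical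
  obtain ⟨a, ha⟩ := hT
  obtain ⟨K, hK, hmax⟩ := Finset.exists_max_image
    (T.powerset.filter fun K => ∃ x y, PathOn G K x y) Finset.card
    ⟨{a}, by simp only [Finset.mem_filter, Finset.mem_powerset]
             exact ⟨by simpa using ha, a, a, PathOn.single a⟩⟩
  simp only [Finset.mem_filter, Finset.mem_powerset] at hK hmax
  obtain ⟨hKT, x, y, h⟩ := hK
  exact ⟨K, x, y, h, hKT, fun K' x' y' h' hK' => hmax K' ⟨hK', x', y', h'⟩⟩

theorem nbrsIn_subset_of_longest {T K : Finset V} {x y : V} (h : PathOn G K x y) (hKT : K ⊆ T)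
    (hmax : ∀ K' x' y', PathOn G K' x' y' → K' ⊆ T → K'.card ≤ K.card) : nbrsIn G T x ⊆ K := by
  intro w hw
  rw [mem_nbrsIn] at hw
  by_contra hwK
  have := hmax _ _ _ (h.cons hwK hw.2.symm) (Finset.insert_subset hw.1 hKT)
  rw [Finset.card_insert_of_notMem hwK] at this
  omega

/-- If a path spans a cycle, its vertex set has no edges leaving it unless there is a longer
path. -/
theorem CycOn.no_edges {T K : Finset V} {x y : V} (h : CycOn G K x y) (hKT : K ⊆ T)
    (hmax : ∀ K' x' y', PathOn G K' x' y' → K' ⊆ T → K'.card ≤ K.card) :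
    ∀ u ∈ K, ∀ v ∈ T, v ∉ K → ¬ G.Adj u v := by
  intro u hu v hv hvK huv
  obtain ⟨z, hz⟩ := h.rotate hu
  have := hmax _ _ _ (hz.1.cons hvK huv.symm) (Finset.insert_subset hv hKT)
  rw [Finset.card_insert_of_notMem hvK] at this
  omega

theorem CycOn.no_edges_of_card {K : Finset V} {x y : V} (hG : PathNineFree G) (h : CycOn G K x y)
    (hK : K.card = 8) : ∀ u ∈ K, ∀ v, v ∉ K → ¬ G.Adj u v := by
  intro u hu v hvK huv
  obtain ⟨z, hz⟩ := h.rotate hu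
  have := hG _ _ _ (hz.1.cons hvK huv.symm)
  rw [Finset.card_insert_of_notMem hvK] at this
  omega

/-- A crossing edge `u v` with `v` adjacent to `x` and `u` adjacent to `y` lets the path be rerouted
as u … x v … y, closed by `y u`. The set `S` bounds the possible predecessors: all of `K` but `y` in
general, one colour class in the bipartite case. -/
theorem PathOn.exists_cycOn {K A B S : Finset V} {x y : V} (h : PathOn G K x y)
    (hA : ∀ a ∈ A, a ∈ K ∧ G.Adj x a) (hB : ∀ b ∈ B, b ∈ K ∧ G.Adj y b) (hBS : B ⊆ S)
    (hAS : ∀ u ∈ K, ∀ v ∈ A, G.Adj u v → u ≠ y → u ∈ S) (hc : S.card < A.card + B.card) :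
    ∃ x' y', CycOn G K x' y' := by
  obtain ⟨K₁, K₂, u, v, h₁, h₂, huv, hd, hK, hv, hu⟩ :=
    h.exists_crossing_edge (A := A) (B := B) (S := S) (fun a ha => (hA a ha).1)
      (fun hx => G.loopless.irrefl _ (hA x hx).2) (fun b hb => (hB b hb).1)
      (fun hy => G.loopless.irrefl _ (hB y hy).2) hBS hAS hc
  refine ⟨u, y, ?_, (hB u hu).2⟩
  rw [← hK]
  exact h₁.symm.append h₂ hd (hA v hv).2

theorem PathOn.exists_cycOn_of_degrees {T K : Finset V} {x y : V} (h : PathOn G K x y)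
    (hx : nbrsIn G T x ⊆ K) (hy : nbrsIn G T y ⊆ K)
    (hc : K.card ≤ (nbrsIn G T x).card + (nbrsIn G T y).card) : ∃ x' y', CycOn G K x' y' := by
  have := Finset.card_erase_add_one h.right_mem
  refine h.exists_cycOn (A := nbrsIn G T x) (B := nbrsIn G T y) (S := K.erase y)
    (fun a ha => ⟨hx ha, (mem_nbrsIn.1 ha).2⟩) (fun a ha => ⟨hy ha, (mem_nbrsIn.1 ha).2⟩)
    (fun b hb => Finset.mem_erase.2 ⟨?_, hy hb⟩)
    (fun u hu v _ _ huy => Finset.mem_erase.2 ⟨huy, hu⟩) (by omega)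
  rintro rfl
  exact notMem_nbrsIn_self hb

/-- Dirac's theorem. -/
theorem exists_hamiltonian_cycle {T : Finset V} (hT : T.Nonempty) (hconn : ConnOn G T)
    (hdeg : ∀ v ∈ T, T.card ≤ 2 * (nbrsIn G T v).card) : ∃ x y, CycOn G T x y := by
  obtain ⟨K, x, y, h, hKT, hmax⟩ := exists_longest_path (G := G) hT
  have hx := nbrsIn_subset_of_longest h hKT hmax
  have hy := nbrsIn_subset_of_longest h.symm hKT hmax
  have h1 := hdeg x (hKT h.left_mem)
  have h2 := hdeg y (hKT h.right_mem)
  have h3 := Finset.card_le_card hKT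
  obtain ⟨x', y', hc⟩ := h.exists_cycOn_of_degrees hx hy (by omega)
  by_cases hK : K = T
  · exact ⟨x', y', hK ▸ hc⟩
  · obtain ⟨u, hu, v, hv, hvK, huv⟩ := hconn K hKT ⟨x, h.left_mem⟩ hK
    exact absurd huv (hc.no_edges hKT hmax u hu v hv hvK)

/-- All neighbours of `x` lie on `K`, and `K` without `x` is still a path. A set that splits this
path has an edge of the path leaving it; otherwise the set or its complement avoids all neighbours
of `x`, so the edge supplied by `T` does not use `x`. -/
theorem ConnOn.erase_of_longest {T K : Finset V} {x y : V} (hconn : ConnOn G T)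
    (h : PathOn G K x y) (hKT : K ⊆ T) (hK : 2 ≤ K.card) (hx : nbrsIn G T x ⊆ K) :
    ConnOn G (T.erase x) := by
  intro S hS hne hST
  obtain ⟨s, hs, hxs⟩ := h.tail hK
  have hxT := hKT h.left_mem
  have hxS : x ∉ S := fun hx => by simpa using hS hx
  have hST' : S ⊆ T := hS.trans (Finset.erase_subset _ _)
  have hKx : ∀ w ∈ T, G.Adj w x → w ∈ K.erase x := fun w hw hwx =>
    Finset.mem_erase.2 ⟨hwx.ne, hx (mem_nbrsIn.2 ⟨hw, hwx.symm⟩)⟩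
  have hKT' : ∀ w ∈ K.erase x, w ∈ T.erase x := fun w hw =>
    Finset.mem_erase.2 ⟨(Finset.mem_erase.1 hw).1, hKT (Finset.mem_erase.1 hw).2⟩
  by_cases h1 : ∃ a ∈ K.erase x, a ∈ S
  · by_cases h2 : ∃ b ∈ K.erase x, b ∉ S
    · obtain ⟨a, ha, haS⟩ := h1
      obtain ⟨b, hb, hbS⟩ := h2
      obtain ⟨u, -, v, hv, huv, huS, hvS⟩ := hs.exists_crossing (S := (S : Set V)) ha haS hb hbS
      exact ⟨u, huS, v, hKT' v hv, hvS, huv⟩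
    · push Not at h2
      obtain ⟨u, hu, v, hv, hvR, huv⟩ := hconn ((T.erase x) \ S)
        (Finset.sdiff_subset.trans (Finset.erase_subset _ _))
        (by rw [Finset.sdiff_nonempty]; exact fun h => hST (hS.antisymm h))
        (fun h => by rw [← h] at hxT; simp at hxT)
      rw [Finset.mem_sdiff] at hu
      have huT := Finset.mem_of_mem_erase hu.1
      have hvx : v ≠ x := by
        rintro rfl
        exact hu.2 (h2 u (hKx u huT huv))
      refine ⟨v, ?_, u, hu.1, hu.2, huv.symm⟩
      by_contra hvS
      exact hvR (Finset.mem_sdiff.2 ⟨Finset.mem_erase.2 ⟨hvx, hv⟩, hvS⟩)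
  · push Not at h1
    obtain ⟨u, hu, v, hv, hvS, huv⟩ := hconn S hST' hne (fun h => hxS (h ▸ hxT))
    refine ⟨u, hu, v, Finset.mem_erase.2 ⟨?_, hv⟩, hvS, huv⟩
    rintro rfl
    exact h1 u (hKx u (hST' hu) huv) hu

/-- In a connected graph without a path on nine vertices, each connected set of at least eight
vertices has a vertex of degree at most three whose removal leaves it connected. -/
theorem ConnOn.exists_removable {M T : Finset V} (hG : PathNineFree G) (hM : ConnOn G M)
    (hMc : 9 ≤ M.card) (hT : ConnOn G T) (hTM : T ⊆ M) (hTc : 8 ≤ T.card) :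
    ∃ u ∈ T, (nbrsIn G T u).card ≤ 3 ∧ ConnOn G (T.erase u) := by
  have hTne : T.Nonempty := Finset.card_pos.1 (by omega)
  obtain ⟨K, x, y, h, hKT, hmax⟩ := exists_longest_path (G := G) hTne
  have hx := nbrsIn_subset_of_longest h hKT hmax
  have hy := nbrsIn_subset_of_longest h.symm hKT hmax
  have hK8 := hG _ _ _ h
  have hK2 : 2 ≤ K.card := by
    obtain ⟨u, hu, v, hv, hvK, huv⟩ := hT {x} (by simpa using hKT h.left_mem) (by simp)
      (fun h => by rw [← h] at hTc; simp at hTc)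
    simp only [Finset.mem_singleton] at hu hvK
    subst hu
    have := Finset.card_le_card (show {u, v} ⊆ K by
      intro w hw
      rcases Finset.mem_insert.1 hw with rfl | hw
      · exact h.left_mem
      · rw [Finset.mem_singleton] at hw; subst hw; exact hx (mem_nbrsIn.2 ⟨hv, huv⟩))
    rwa [Finset.card_pair huv.ne] at this
  by_cases h3 : (nbrsIn G T x).card ≤ 3
  · exact ⟨x, hKT h.left_mem, h3, hT.erase_of_longest h hKT hK2 hx⟩
  by_cases h4 : (nbrsIn G T y).card ≤ 3
  · exact ⟨y, hKT h.right_mem, h4, hT.erase_of_longest h.symm hKT hK2 hy⟩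
  -- Both ends have degree at least 4 and the path at most 8 vertices, so it closes to a cycle.
  -- Maximality makes it span `T`, hence it has exactly 8 vertices, and an edge of `M` leaving it
  -- gives a ninth.
  exfalso
  obtain ⟨x', y', hc⟩ := h.exists_cycOn_of_degrees hx hy (by omega)
  have hKeq : K = T := by
    by_contra hK
    obtain ⟨u, hu, v, hv, hvK, huv⟩ := hT K hKT ⟨x, h.left_mem⟩ hK
    exact hc.no_edges hKT hmax u hu v hv hvK huv
  subst hKeq
  obtain ⟨u, hu, v, hv, hvK, huv⟩ := hM K hTM ⟨x, h.left_mem⟩ (fun h => by rw [h] at hK8; omega)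
  exact hc.no_edges_of_card hG (by omega) u hu v hvK huv

/-- `M` is obtained from `T` by repeatedly adding vertices of back-degree at most three. -/
inductive ThreeBuilt (G : SimpleGraph V) (M : Finset V) : Finset V → Prop
  | refl : ThreeBuilt G M M
  | step {T : Finset V} (y : V) (hyM : y ∈ M) (hyT : y ∉ T) (hd : (nbrsIn G T y).card ≤ 3)
      (h : ThreeBuilt G M (insert y T)) : ThreeBuilt G M T

namespace ThreeBuilt

variable {M T : Finset V}

theorem subset (h : ThreeBuilt G M T) : T ⊆ M := by
  induction h with
  | refl => exact Finset.Subset.refl _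
  | step y _ _ _ _ ih => exact (Finset.subset_insert _ _).trans ih

theorem degSum_le (h : ThreeBuilt G M T) : degSum G M + 6 * T.card ≤ degSum G T + 6 * M.card := by
  induction h with
  | refl => exact le_rfl
  | step y _ hyT hd _ ih =>
    rw [degSum_insert hyT, Finset.card_insert_of_notMem hyT] at ih
    omega

theorem card_nbrsIn_le (h : ThreeBuilt G M T) {v : V} (hv : v ∈ M) (hvT : v ∉ T) :
    (nbrsIn G T v).card ≤ 3 := by
  induction h with
  | refl => exact absurd hv hvT
  | @step T y _ _ hd _ ih =>
    by_cases hvy : v = y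
    · exact hvy ▸ hd
    · exact (Finset.card_le_card (nbrsIn_mono (Finset.subset_insert _ _) v)).trans
        (ih (by simp [hvy, hvT]))

theorem exists_step (h : ThreeBuilt G M T) (hT : T.card < M.card) :
    ∃ y ∈ M, y ∉ T ∧ ThreeBuilt G M (insert y T) := by
  cases h with
  | refl => omega
  | step y hyM hyT hd h => exact ⟨y, hyM, hyT, h⟩

theorem erase (h : ThreeBuilt G M T) {u : V} (hu : u ∈ T) (hd : (nbrsIn G T u).card ≤ 3) :
    ThreeBuilt G M (T.erase u) := by
  refine step u (h.subset hu) (by simp) ?_ (by rwa [Finset.insert_erase hu])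
  exact (Finset.card_le_card (nbrsIn_mono (Finset.erase_subset _ _) _)).trans hd

end ThreeBuilt

theorem ConnOn.exists_threeBuilt {M : Finset V} (hG : PathNineFree G) (hM : ConnOn G M)
    (hMc : 9 ≤ M.card) : ∃ T, ThreeBuilt G M T ∧ T.card = 7 := by
  have key : ∀ j, j + 7 ≤ M.card → ∃ T, ThreeBuilt G M T ∧ ConnOn G T ∧ T.card + j = M.card := by
    intro j
    induction j with
    | zero => exact fun _ => ⟨M, .refl, hM, rfl⟩
    | succ j ih =>
      intro hj
      obtain ⟨T, hb, hT, hc⟩ := ih (by omega)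
      obtain ⟨u, hu, hd, hT'⟩ := ConnOn.exists_removable hG hM hMc hT hb.subset (by omega)
      have := Finset.card_erase_add_one hu
      exact ⟨T.erase u, hb.erase hu hd, hT', by omega⟩
  obtain ⟨T, hb, -, hc⟩ := key (M.card - 7) (by omega)
  exact ⟨T, hb, by omega⟩

end DegreesAndConnectivity

/-! ### Small dense sets are Hamilton connected. -/

section HamiltonConnectedSets

variable {V : Type*} [DecidableEq V] {G : SimpleGraph V}

theorem connOn_of_degrees {T : Finset V} (hdeg : ∀ v ∈ T, T.card ≤ 2 * (nbrsIn G T v).card) :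
    ConnOn G T := by
  intro S hS hne hST
  by_contra! hno
  obtain ⟨u, hu⟩ := hne
  obtain ⟨v, hv, hvS⟩ := Finset.exists_of_ssubset (Finset.ssubset_iff_subset_ne.2 ⟨hS, hST⟩)
  have h1 : nbrsIn G T u ⊆ S.erase u := by
    intro w hw
    rw [mem_nbrsIn] at hw
    refine Finset.mem_erase.2 ⟨hw.2.ne', ?_⟩
    by_contra hwS
    exact hno u hu w hw.1 hwS hw.2
  have h2 : nbrsIn G T v ⊆ (T \ S).erase v := by
    intro w hw
    rw [mem_nbrsIn] at hw
    refine Finset.mem_erase.2 ⟨hw.2.ne', Finset.mem_sdiff.2 ⟨hw.1, ?_⟩⟩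
    exact fun hwS => hno w hwS v hv hvS hw.2.symm
  have h1 := Finset.card_le_card h1
  have h2 := Finset.card_le_card h2
  have e1 := Finset.card_erase_add_one hu
  have e2 := Finset.card_erase_add_one (Finset.mem_sdiff.2 ⟨hv, hvS⟩)
  have e3 := Finset.card_sdiff_add_card_eq_card hS
  have := hdeg u (hS hu)
  have := hdeg v hv
  omega

/-- Any two vertices of `K` are the ends of a path with vertex set `K`. -/
def HamConn (G : SimpleGraph V) (K : Finset V) : Prop :=
  ∀ x ∈ K, ∀ y ∈ K, x ≠ y → PathOn G K x y

theorem card_nbrsIn_add_le_of_not_adj {K L : Finset V} {v : V} (hL : L ⊆ K)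
    (h : ∀ w ∈ L, ¬ G.Adj v w) : (nbrsIn G K v).card + L.card ≤ K.card := by
  have : nbrsIn G K v ⊆ K \ L := fun w hw => Finset.mem_sdiff.2
    ⟨(mem_nbrsIn.1 hw).1, fun hwL => h w hwL (mem_nbrsIn.1 hw).2⟩
  have := Finset.card_le_card this
  have := Finset.card_sdiff_add_card_eq_card hL
  omega

theorem PathOn.ne_of_two_le_card {K : Finset V} {x y : V} (h : PathOn G K x y)
    (hK : 2 ≤ K.card) : x ≠ y := by
  obtain ⟨s, hs, -⟩ := h.tail hK
  exact (Finset.mem_erase.1 hs.right_mem).1.symm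

theorem adj_of_card_seven {K : Finset V} (hK : K.card = 7)
    (hdeg : ∀ v ∈ K, 4 ≤ (nbrsIn G K v).card) {v a b c : V} (hl : ∀ w ∈ [v, a, b, c], w ∈ K)
    (hn : [v, a, b, c].Nodup) (ha : ¬ G.Adj v a) (hb : ¬ G.Adj v b) : G.Adj v c := by
  by_contra hc
  have := card_nbrsIn_add_le_of_not_adj (G := G) (K := K) (L := [v, a, b, c].toFinset) (v := v)
    (fun w hw => hl w (List.mem_toFinset.1 hw))
    (by
      intro w hw
      simp only [List.mem_toFinset, List.mem_cons, List.not_mem_nil, or_false] at hw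
      rcases hw with rfl | rfl | rfl | rfl
      exacts [G.loopless.irrefl _, ha, hb, hc])
  rw [List.toFinset_card_of_nodup hn] at this
  have := hdeg v (hl v (by simp))
  simp only [List.length_cons, List.length_nil] at *
  omega

/-- Dirac gives a cycle through everything but `y`. Since `y` misses at most one other vertex, it is
adjacent to one of the two cycle neighbours of `x`; cutting the cycle there yields the path. -/
theorem hamConn_of_missing_one {K : Finset V} (hK : 5 ≤ K.card)
    (hdeg : ∀ v ∈ K, K.card ≤ (nbrsIn G K v).card + 2) : HamConn G K := by
  intro x hx y hy hxy
  have hT := Finset.card_erase_add_one hy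
  have hdegT : ∀ v ∈ K.erase y, (K.erase y).card ≤ 2 * (nbrsIn G (K.erase y) v).card := by
    intro v hv
    have := hdeg v (Finset.mem_of_mem_erase hv)
    have := card_nbrsIn_le_erase (G := G) (T := K) (u := y) (v := v)
    omega
  have hxT : x ∈ K.erase y := Finset.mem_erase.2 ⟨hxy, hx⟩
  obtain ⟨p, q, hc⟩ := exists_hamiltonian_cycle ⟨x, hxT⟩ (connOn_of_degrees hdegT) hdegT
  obtain ⟨z, hz, hzx⟩ := hc.rotate hxT
  by_cases hzy : G.Adj z y
  · have := hz.snoc (by simp) hzy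
    rwa [Finset.insert_erase hy] at this
  obtain ⟨s, hs, hxs⟩ := hz.tail (by omega)
  have hzs : z ≠ s := by
    have := Finset.card_erase_add_one hxT
    exact (hs.ne_of_two_le_card (by omega)).symm
  have hsy : G.Adj s y := by
    by_contra hsy
    have hzK := Finset.mem_of_mem_erase hz.right_mem
    have hsT := Finset.mem_of_mem_erase hs.left_mem
    have := card_nbrsIn_add_le_of_not_adj (G := G) (K := K) (L := {y, z, s}) (v := y)
      (by
        intro w hw
        simp only [Finset.mem_insert, Finset.mem_singleton] at hw
        rcases hw with rfl | rfl | rfl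
        exacts [hy, hzK, Finset.mem_of_mem_erase hsT])
      (by
        intro w hw
        simp only [Finset.mem_insert, Finset.mem_singleton] at hw
        rcases hw with rfl | rfl | rfl
        exacts [G.loopless.irrefl _, fun h => hzy h.symm, fun h => hsy h.symm])
    have hyz : y ≠ z := fun h => (Finset.mem_erase.1 hz.right_mem).1 h.symm
    have hys : y ≠ s := fun h => (Finset.mem_erase.1 hsT).1 h.symm
    rw [Finset.card_eq_three.2 ⟨y, z, s, hyz, hys, hzs, rfl⟩] at this
    have := hdeg y hy
    omega
  have := (hs.symm.cons (by simp) hzx.symm).snoc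
    (by rw [Finset.insert_erase hxT]; simp) hsy
  rwa [Finset.insert_erase hxT, Finset.insert_erase hy] at this

theorem PathOn.of_list_eq {K : Finset V} {x y : V} (l : List V)
    (hc : (x :: (l ++ [y])).IsChain G.Adj) (hn : (x :: (l ++ [y])).Nodup)
    (hK : ∀ w, w ∈ x :: (l ++ [y]) ↔ w ∈ K) : PathOn G K x y := by
  have hK' : (x :: (l ++ [y])).toFinset = K := by
    ext w
    rw [List.mem_toFinset, hK]
  subst hK'
  clear hK
  induction l generalizing x with
  | nil =>
    simp at hc hn
    simpa using PathOn.cons (PathOn.single y) (by simpa using hn) hc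
  | cons s l ih =>
    rw [List.cons_append, List.isChain_cons_cons] at hc
    rw [List.cons_append, List.nodup_cons] at hn
    rw [List.toFinset_cons, List.cons_append]
    exact cons (ih hc.2 hn.2) (by rw [List.mem_toFinset]; exact hn.1) hc.1

/-- Again a Dirac cycle x c₁ … c₅ avoids `y`. Every vertex has at most two non-neighbours, so if `y`
misses both c₁ and c₅ it sees c₂ and c₃, and c₁, which misses `y`, sees c₄ or c₅. Each case gives an
explicit path. -/
theorem hamConn_of_card_seven {K : Finset V} (hK : K.card = 7)
    (hdeg : ∀ v ∈ K, 4 ≤ (nbrsIn G K v).card) : HamConn G K := by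
  intro x hx y hy hxy
  have hT := Finset.card_erase_add_one hy
  have hdegT : ∀ v ∈ K.erase y, (K.erase y).card ≤ 2 * (nbrsIn G (K.erase y) v).card := by
    intro v hv
    have := hdeg v (Finset.mem_of_mem_erase hv)
    have := card_nbrsIn_le_erase (G := G) (T := K) (u := y) (v := v)
    omega
  have hxT : x ∈ K.erase y := Finset.mem_erase.2 ⟨hxy, hx⟩
  obtain ⟨p, q, hc⟩ := exists_hamiltonian_cycle ⟨x, hxT⟩ (connOn_of_degrees hdegT) hdegT
  obtain ⟨c₅, h₀, h50⟩ := hc.rotate hxT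
  have k0 := Finset.card_erase_add_one h₀.left_mem
  obtain ⟨c₁, h₁, h01⟩ := h₀.tail (by omega)
  have k1 := Finset.card_erase_add_one h₁.left_mem
  obtain ⟨c₂, h₂, h12⟩ := h₁.tail (by omega)
  have k2 := Finset.card_erase_add_one h₂.left_mem
  obtain ⟨c₃, h₃, h23⟩ := h₂.tail (by omega)
  have k3 := Finset.card_erase_add_one h₃.left_mem
  obtain ⟨c₄, h₄, h34⟩ := h₃.tail (by omega)
  have k4 := Finset.card_erase_add_one h₄.left_mem
  obtain ⟨c₅', h₅, h45⟩ := h₄.tail (by omega)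
  have k5 := Finset.card_erase_add_one h₅.left_mem
  have h₅' : c₅' = c₅ := by
    obtain ⟨a, ha⟩ := Finset.card_eq_one.1
      (show (((((((K.erase y).erase x).erase c₁).erase c₂).erase c₃).erase c₄).card = 1) by omega)
    have h1 := h₅.right_mem
    have h2 := h₅.left_mem
    rw [ha, Finset.mem_singleton] at h1 h2
    exact h2.trans h1.symm
  subst h₅'
  have m1 := h₁.left_mem
  have m2 := h₂.left_mem
  have m3 := h₃.left_mem
  have m4 := h₄.left_mem
  have m5 := h₅.left_mem
  simp only [Finset.mem_erase] at m1 m2 m3 m4 m5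
  have hl : ∀ w ∈ [x, c₁, c₂, c₃, c₄, c₅', y], w ∈ K := by
    simp only [List.mem_cons, List.not_mem_nil, or_false]
    rintro w (rfl | rfl | rfl | rfl | rfl | rfl | rfl)
    exacts [hx, m1.2.2, m2.2.2.2, m3.2.2.2.2, m4.2.2.2.2.2, m5.2.2.2.2.2.2, hy]
  clear h₁ h₂ h₃ h₄ h₅ k0 k1 k2 k3 k4 k5 hxT hdegT hc h₀ hT
  have hn : [x, c₁, c₂, c₃, c₄, c₅', y].Nodup := by
    simp only [List.nodup_cons, List.mem_cons, List.not_mem_nil, or_false, not_or]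
    grind
  have nd1 : [y, c₁, c₅', c₂].Nodup := by clear hdeg; grind
  have nd2 : [y, c₁, c₅', c₃].Nodup := by clear hdeg; grind
  have nd3 : [c₁, y, c₄, c₅'].Nodup := by clear hdeg; grind
  have hset : ∀ l : List V, l.Perm [x, c₁, c₂, c₃, c₄, c₅', y] → ∀ w, w ∈ l ↔ w ∈ K := by
    intro l hp
    have : [x, c₁, c₂, c₃, c₄, c₅', y].toFinset = K := by
      apply Finset.eq_of_subset_of_card_le
      · exact fun w hw => hl w (List.mem_toFinset.1 hw)
      · rw [List.toFinset_card_of_nodup hn, hK]; rfl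
    intro w
    rw [← this, List.mem_toFinset]
    exact hp.mem_iff
  have build : ∀ l, (x :: (l ++ [y])).IsChain G.Adj →
      (x :: (l ++ [y])).Perm [x, c₁, c₂, c₃, c₄, c₅', y] → PathOn G K x y := fun l hc hp =>
    PathOn.of_list_eq l hc (hp.nodup_iff.2 hn) (hset _ hp)
  have perm : ∀ l : List V, l.length = 7 → [x, c₁, c₂, c₃, c₄, c₅', y] ⊆ l →
      l.Perm [x, c₁, c₂, c₃, c₄, c₅', y] := fun l hl hs =>
    ((List.subperm_of_subset hn hs).perm_of_length_le (by simp [hl])).symm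
  by_cases h1y : G.Adj c₁ y
  · refine build [c₅', c₄, c₃, c₂, c₁] ?_ (perm _ rfl (by simp))
    simp [h50.symm, h45.symm, h34.symm, h23.symm, h12.symm, h1y]
  by_cases h5y : G.Adj c₅' y
  · refine build [c₁, c₂, c₃, c₄, c₅'] ?_ (perm _ rfl (by simp))
    simp [h01, h12, h23, h34, h45, h5y]
  have h2y : G.Adj c₂ y := (adj_of_card_seven hK hdeg (fun w hw => hl w (by
    revert w; simp)) nd1 (fun h => h1y h.symm) (fun h => h5y h.symm)).symm
  have h3y : G.Adj c₃ y := (adj_of_card_seven hK hdeg (fun w hw => hl w (by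
    revert w; simp)) nd2 (fun h => h1y h.symm) (fun h => h5y h.symm)).symm
  by_cases h14 : G.Adj c₁ c₄
  · refine build [c₅', c₄, c₁, c₂, c₃] ?_ (perm _ rfl (by simp))
    simp [h50.symm, h45.symm, h14.symm, h12, h23, h3y]
  · have h15 : G.Adj c₁ c₅' := adj_of_card_seven hK hdeg (fun w hw => hl w (by
      revert w; simp)) nd3 h1y h14
    refine build [c₁, c₅', c₄, c₃, c₂] ?_ (perm _ rfl (by simp))
    simp [h01, h15, h45.symm, h34.symm, h23.symm, h2y]

theorem PathOn.of_clique {Q : Finset V} (hQ : ∀ u ∈ Q, ∀ v ∈ Q, u ≠ v → G.Adj u v) {x y : V}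
    (hx : x ∈ Q) (hy : y ∈ Q) (hxy : x ≠ y) : PathOn G Q x y := by
  induction Q using Finset.strongInduction generalizing x with
  | H Q ih =>
    by_cases h : ∃ z ∈ Q, z ≠ x ∧ z ≠ y
    · obtain ⟨z, hz, hzx, hzy⟩ := h
      have := (ih (Q.erase x) (Finset.erase_ssubset hx)
        (fun u hu v hv => hQ u (Finset.mem_of_mem_erase hu) v (Finset.mem_of_mem_erase hv))
        (Finset.mem_erase.2 ⟨hzx, hz⟩) (Finset.mem_erase.2 ⟨hxy.symm, hy⟩) hzy).cons
        (by simp) (hQ x hx z hz hzx.symm)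
      rwa [Finset.insert_erase hx] at this
    · push Not at h
      have : Q = insert x {y} := by
        ext w
        simp only [Finset.mem_insert, Finset.mem_singleton]
        constructor
        · intro hw
          by_cases hwx : w = x
          · exact Or.inl hwx
          · exact Or.inr (h w hw hwx)
        · rintro (rfl | rfl) <;> assumption
      rw [this]
      exact (PathOn.single y).cons (by simpa using hxy) (hQ x hx y hy hxy)

/-- A clique together with one more vertex `w` is Hamilton connected up to the obvious
obstruction. -/
theorem PathOn.of_clique_insert {Q : Finset V} (hQ : ∀ u ∈ Q, ∀ v ∈ Q, u ≠ v → G.Adj u v)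
    {w x y : V} (hw : w ∉ Q) (hx : x ∈ insert w Q) (hy : y ∈ insert w Q) (hxy : x ≠ y)
    (h2 : 2 ≤ (nbrsIn G Q w).card) (hN : ¬ nbrsIn G Q w ⊆ {x, y}) :
    PathOn G (insert w Q) x y := by
  have key : ∀ y ∈ Q, ¬ nbrsIn G Q w ⊆ {w, y} → PathOn G (insert w Q) w y := by
    intro y hy hN
    obtain ⟨u, hu, huy⟩ := Finset.not_subset.1 hN
    rw [mem_nbrsIn] at hu
    simp only [Finset.mem_insert, Finset.mem_singleton, not_or] at huy
    exact (PathOn.of_clique hQ hu.1 hy huy.2).cons hw hu.2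
  rcases Finset.mem_insert.1 hx with rfl | hxQ
  · exact key y (by simpa [hxy.symm] using hy) hN
  rcases Finset.mem_insert.1 hy with rfl | hyQ
  · exact (key x hxQ (by rwa [Finset.pair_comm])).symm
  obtain ⟨v, hv, hvxy⟩ := Finset.not_subset.1 hN
  obtain ⟨u, hu, huv⟩ := Finset.exists_mem_ne (show 1 < (nbrsIn G Q w).card by omega) v
  rw [mem_nbrsIn] at hu hv
  simp only [Finset.mem_insert, Finset.mem_singleton, not_or] at hvxy
  -- The path passes `w` between `u` and `v`: it is x w v … y if `u = x`, and x u w v … y otherwise.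
  -- The remaining case `u = y` is this one reversed.
  have general : ∀ x ∈ Q, ∀ y ∈ Q, x ≠ y → v ≠ x → v ≠ y → u ≠ y →
      PathOn G (insert w Q) x y := by
    intro x hx y hy hxy hvx hvy huy
    have hwx : w ≠ x := by rintro rfl; exact hw hx
    by_cases hux : u = x
    · subst hux
      have h1 : PathOn G (Q.erase u) v y := PathOn.of_clique
        (fun a ha b hb => hQ a (Finset.mem_of_mem_erase ha) b (Finset.mem_of_mem_erase hb))
        (Finset.mem_erase.2 ⟨hvx, hv.1⟩) (Finset.mem_erase.2 ⟨hxy.symm, hy⟩) hvy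
      have h2 := (h1.cons (x := w) (by simp [hw]) hv.2).cons (x := u) (by simp [hwx.symm])
        hu.2.symm
      rwa [Finset.insert_comm, Finset.insert_erase hx] at h2
    · have hxu : x ∉ (Q.erase x).erase u := by simp
      have h1 : PathOn G ((Q.erase x).erase u) v y := PathOn.of_clique
        (fun a ha b hb => hQ a (Finset.mem_of_mem_erase (Finset.mem_of_mem_erase ha)) b
          (Finset.mem_of_mem_erase (Finset.mem_of_mem_erase hb)))
        (by simp [huv.symm, hvx, hv.1]) (by simp [huy.symm, hxy.symm, hy]) hvy
      have hwu : w ≠ u := by rintro rfl; exact hw hu.1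
      have h2 := ((h1.cons (x := w) (by simp [hw]) hv.2).cons (x := u) (by simp [hwu.symm])
        hu.2.symm).cons (x := x) (by simp [hwx.symm, Ne.symm hux]) (hQ x hx u hu.1 (Ne.symm hux))
      rwa [Finset.insert_comm u w, Finset.insert_erase (Finset.mem_erase.2 ⟨hux, hu.1⟩),
        Finset.insert_comm x w, Finset.insert_erase hx] at h2
  by_cases huy : u = y
  · exact (general y hyQ x hxQ hxy.symm hvxy.2 hvxy.1 (by rw [huy]; exact hxy.symm)).symm
  · exact general x hxQ y hyQ hxy hvxy.1 hvxy.2 huy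

end HamiltonConnectedSets

/-! ### Connected graphs without a nine-vertex path: the bound 3m - 5 and its equality case. -/

section ConnectedGraphs

variable {V : Type*} [DecidableEq V] {G : SimpleGraph V} {M K : Finset V}

theorem ThreeBuilt.exists_step_card {T : Finset V} (h : ThreeBuilt G M T) (hT : T.card < M.card) :
    ∃ y ∈ M, y ∉ T ∧ ThreeBuilt G M (insert y T) ∧ (insert y T).card = T.card + 1 ∧
      degSum G (insert y T) = degSum G T + 2 * (nbrsIn G T y).card ∧
      (nbrsIn G T y).card ≤ 3 := by
  obtain ⟨y, hyM, hyT, h'⟩ := h.exists_step hT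
  exact ⟨y, hyM, hyT, h', Finset.card_insert_of_notMem hyT, degSum_insert hyT,
    h.card_nbrsIn_le hyM hyT⟩

/-- The hypothesis says that the additions fall at most two edges short of three per vertex, so the
first three bring at least 9 - 2 = 7. -/
theorem ThreeBuilt.exists_three_steps (hb : ThreeBuilt G M K) (hM : K.card + 3 ≤ M.card)
    (hd : degSum G K + 6 * M.card ≤ degSum G M + 6 * K.card + 4) :
    ∃ u ∈ M, u ∉ K ∧ ∃ v ∈ M, v ∉ insert u K ∧ ∃ w ∈ M, w ∉ insert v (insert u K) ∧
      (nbrsIn G K u).card ≤ 3 ∧ (nbrsIn G (insert u K) v).card ≤ 3 ∧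
      (nbrsIn G (insert v (insert u K)) w).card ≤ 3 ∧
      7 ≤ (nbrsIn G K u).card + (nbrsIn G (insert u K) v).card +
        (nbrsIn G (insert v (insert u K)) w).card := by
  obtain ⟨u, hu, huK, b1, c1, d1, e1⟩ := hb.exists_step_card (by omega)
  obtain ⟨v, hv, hvK, b2, c2, d2, e2⟩ := b1.exists_step_card (by omega)
  obtain ⟨w, hw, hwK, b3, c3, d3, e3⟩ := b2.exists_step_card (by omega)
  refine ⟨u, hu, huK, v, hv, hvK, w, hw, hwK, e1, e2, e3, ?_⟩
  have := b3.degSum_le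
  omega

theorem card_nbrsIn_le_of_subset {W : Type*} {G : SimpleGraph W} {T S : Finset W}
    {v : W} {n : ℕ}
    (h : ∀ u ∈ T, G.Adj v u → u ∈ S) (hS : S.card ≤ n) : (nbrsIn G T v).card ≤ n :=
  (Finset.card_le_card fun u hu => h u (mem_nbrsIn.1 hu).1 (mem_nbrsIn.1 hu).2).trans hS

theorem HamConn.exists_path_to (hH : HamConn G K) (hK : 2 ≤ K.card) {x : V} (hx : x ∈ K) :
    ∃ a, PathOn G K a x := by
  obtain ⟨a, ha, hax⟩ := Finset.exists_mem_ne (show 1 < K.card by omega) x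
  exact ⟨a, hH a ha x hx hax⟩

/-- No path with three vertices is attached to a Hamilton connected set of six vertices. -/
theorem HamConn.no_tail (hG : PathNineFree G) (hH : HamConn G K) (hK : K.card = 6) {x u v w : V}
    (hx : x ∈ K) (hu : u ∉ K) (hv : v ∉ K) (hw : w ∉ K) (huw : u ≠ w) (hxu : G.Adj u x)
    (huv : G.Adj u v) (hvw : G.Adj v w) : False := by
  obtain ⟨a, ha⟩ := hH.exists_path_to (by omega) hx
  have hvu : v ∉ insert u K := by simp [hv, huv.ne']
  have hwv : w ∉ insert v (insert u K) := by simp [hw, hvw.ne', huw.symm]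
  have := hG _ _ _ (((ha.snoc hu hxu.symm).snoc hvu huv).snoc hwv hvw)
  rw [Finset.card_insert_of_notMem hwv, Finset.card_insert_of_notMem hvu,
    Finset.card_insert_of_notMem hu] at this
  omega

/-- If `x'` differed from `x`, the path w x' … x u v would have 1 + 6 + 2 = 9 vertices. -/
theorem HamConn.attached_eq (hG : PathNineFree G) (hH : HamConn G K) (hK : K.card = 6)
    {x x' u v w : V} (hx : x ∈ K) (hx' : x' ∈ K) (hu : u ∉ K) (hv : v ∉ K) (hw : w ∉ K)
    (huw : u ≠ w) (hvw : v ≠ w) (hxu : G.Adj u x) (huv : G.Adj u v) (hwx : G.Adj w x') :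
    x' = x := by
  by_contra hne
  have hvu : v ∉ insert u K := by simp [hv, huv.ne']
  have hwv : w ∉ insert v (insert u K) := by simp [hw, hvw.symm, huw.symm]
  have := hG _ _ _ ((((hH x' hx' x hx hne).snoc hu hxu.symm).snoc hvu huv).cons hwv hwx)
  rw [Finset.card_insert_of_notMem hwv, Finset.card_insert_of_notMem hvu,
    Finset.card_insert_of_notMem hu] at this
  omega

/-- An attached edge `y y'` restricts how all other outside vertices attach, so severely that the
first three vertices added to `K` bring at most six edges instead of seven. -/
theorem HamConn.not_adj_outside (hG : PathNineFree G) (hH : HamConn G K) (hK : K.card = 6)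
    (hb : ThreeBuilt G M K) (hM : 9 ≤ M.card)
    (hd : degSum G K + 6 * M.card ≤ degSum G M + 6 * K.card + 4) {x y y' : V} (hx : x ∈ K)
    (hyK : y ∉ K) (hyK' : y' ∉ K) (hyx : G.Adj y x) : ¬ G.Adj y y' := by
  intro hyy
  obtain ⟨u, hu, huK, v, hv, hvK, w, hw, hwK, e1, e2, e3, hsum⟩ :=
    hb.exists_three_steps (by omega) hd
  simp only [Finset.mem_insert, not_or] at hvK hwK
  obtain ⟨hvu, hvK⟩ := hvK
  obtain ⟨hwv, hwu, hwK⟩ := hwK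
  have att : ∀ z, z ∉ K → z ≠ y → z ≠ y' → ∀ x' ∈ K, G.Adj z x' → x' = x :=
    fun z hz hzy hzy' x' hx' hzx => hH.attached_eq hG hK hx hx' hyK hyK' hz hzy.symm hzy'.symm
      hyx hyy hzx
  by_cases h1 : ∃ x' ∈ K, x' ≠ x ∧ (G.Adj y x' ∨ G.Adj y' x')
  · have h0 : ∀ z, z ∉ K → z ≠ y → z ≠ y' → ∀ x' ∈ K, ¬ G.Adj z x' := by
      obtain ⟨x', hx', hne, h⟩ := h1
      intro z hz hzy hzy' x'' hx'' hzx
      have e := att z hz hzy hzy' x'' hx'' hzx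
      subst e
      rcases h with h | h
      · exact hne (hH.attached_eq hG hK hx' hx'' hyK hyK' hz hzy.symm hzy'.symm h hyy hzx).symm
      · exact hne (hH.attached_eq hG hK hx' hx'' hyK' hyK hz hzy'.symm hzy.symm h hyy.symm
          hzx).symm
    by_cases h2 : ∃ x' ∈ K, G.Adj y' x'
    · obtain ⟨x', hx', hyx'⟩ := h2
      have h3 : ∀ z, z ∉ K → z ≠ y → z ≠ y' → ¬ G.Adj z y ∧ ¬ G.Adj z y' :=
        fun z hz hzy hzy' =>
        ⟨fun h => hH.no_tail hG hK hx' hyK' hyK hz hzy'.symm hyx' hyy.symm h.symm,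
         fun h => hH.no_tail hG hK hx hyK hyK' hz hzy.symm hyx hyy h.symm⟩
      have h4 : ∀ z, z ∉ K → z ≠ y → z ≠ y' → ∀ T, T ⊆ insert y (insert y' K) →
          (nbrsIn G T z).card ≤ 0 := by
        intro z hz hzy hzy' T hT
        refine card_nbrsIn_le_of_subset (S := ∅) (fun a ha hza => ?_) (by simp)
        rcases Finset.mem_insert.1 (hT ha) with rfl | ha
        · exact absurd hza (h3 z hz hzy hzy').1
        · rcases Finset.mem_insert.1 ha with rfl | ha
          · exact absurd hza (h3 z hz hzy hzy').2
          · exact absurd hza (h0 z hz hzy hzy' a ha)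
      -- The first of `u`, `v`, `w` outside {y, y'} has back-degree zero, leaving at most 6.
      by_cases hu' : u = y ∨ u = y'
      · by_cases hv' : v = y ∨ v = y'
        · have : (nbrsIn G (insert v (insert u K)) w).card ≤ 0 := by
            apply h4 w hwK
            · rcases hu' with rfl | rfl <;> rcases hv' with rfl | rfl <;> tauto
            · rcases hu' with rfl | rfl <;> rcases hv' with rfl | rfl <;> tauto
            · intro a; simp only [Finset.mem_insert]; rcases hu' with rfl | rfl <;>
                rcases hv' with rfl | rfl <;> tauto
          omega
        · push Not at hv'
          have : (nbrsIn G (insert u K) v).card ≤ 0 := by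
            apply h4 v hvK hv'.1 hv'.2
            intro a; simp only [Finset.mem_insert]; rcases hu' with rfl | rfl <;> tauto
          omega
      · push Not at hu'
        have := h4 u huK hu'.1 hu'.2 K (fun a ha => by simp [ha])
        omega
    · push Not at h2
      have h3 : ∀ z, z ∉ K → z ≠ y → ∀ x' ∈ K, ¬ G.Adj z x' := by
        intro z hz hzy
        by_cases hzy' : z = y'
        · exact hzy' ▸ h2
        · exact h0 z hz hzy hzy'
      -- Only `y` is attached to `K`, so `u = y` and the back-degrees are at most 3, 1, 2.
      by_cases hu' : u = y
      · subst hu'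
        have : (nbrsIn G (insert u K) v).card ≤ 1 := by
          refine card_nbrsIn_le_of_subset (S := {u}) (fun a ha hva => ?_) (by simp)
          rcases Finset.mem_insert.1 ha with rfl | ha
          · simp
          · exact absurd hva (h3 v hvK hvu a ha)
        have : (nbrsIn G (insert v (insert u K)) w).card ≤ 2 := by
          refine card_nbrsIn_le_of_subset (S := {u, v}) (fun a ha hwa => ?_) Finset.card_le_two
          simp only [Finset.mem_insert, Finset.mem_singleton] at ha ⊢
          rcases ha with ha | ha | ha
          · exact Or.inr ha
          · exact Or.inl ha
          · exact absurd hwa (h3 w hwK hwu a ha)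
        omega
      · have : (nbrsIn G K u).card ≤ 0 :=
          card_nbrsIn_le_of_subset (S := ∅) (fun a ha hua => absurd hua (h3 u huK hu' a ha))
            (by simp)
        omega
  · push Not at h1
    have h2 : ∀ z, z ∉ K → ∀ x' ∈ K, G.Adj z x' → x' = x := by
      intro z hz x' hx' hzx
      by_contra hne
      by_cases hzy : z = y
      · exact (h1 x' hx' hne).1 (hzy ▸ hzx)
      by_cases hzy' : z = y'
      · exact (h1 x' hx' hne).2 (hzy' ▸ hzx)
      exact hne (att z hz hzy hzy' x' hx' hzx)
    -- Everything attaches at `x` alone, so the back-degrees are at most 1, 2, 3.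
    have : (nbrsIn G K u).card ≤ 1 :=
      card_nbrsIn_le_of_subset (S := {x}) (fun a ha hua => by simpa using h2 u huK a ha hua)
        (by simp)
    have : (nbrsIn G (insert u K) v).card ≤ 2 := by
      refine card_nbrsIn_le_of_subset (S := {u, x}) (fun a ha hva => ?_) Finset.card_le_two
      rcases Finset.mem_insert.1 ha with rfl | ha
      · simp
      · simp [h2 v hvK a ha hva]
    omega

/-- No edge leaves `K` together with its neighbours, so connectedness makes this set all of `M`;
every outside vertex is then attached to `K` and has no outside neighbour. -/
theorem ConnOn.nbrsIn_subset_of_not_adj (hM : ConnOn G M) (hKM : K ⊆ M) (hK : K.Nonempty)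
    (h : ∀ x ∈ K, ∀ y, y ∉ K → ∀ z, z ∉ K → G.Adj y x → ¬ G.Adj y z) :
    ∀ y ∈ M, y ∉ K → ∀ z ∈ M, G.Adj y z → z ∈ K := by
  classical
  have hall : ∀ y ∈ M, y ∉ K → ∃ x ∈ K, G.Adj y x := by
    by_contra! hne
    obtain ⟨y, hy, hyK, hyx⟩ := hne
    obtain ⟨u, hu, v, hv, hvS, huv⟩ := hM (M.filter fun y => y ∈ K ∨ ∃ x ∈ K, G.Adj y x)
      (Finset.filter_subset _ _)
      (hK.imp fun x hx => by simp [hx, hKM hx])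
      (fun h => by
        rw [← h, Finset.mem_filter] at hy
        rcases hy.2 with h' | ⟨x, hx, h'⟩
        exacts [hyK h', hyx x hx h'])
    simp only [Finset.mem_filter, hv, true_and, not_or, not_exists, not_and] at hu hvS
    rcases hu.2 with hu' | ⟨x, hx, hux⟩
    · exact hvS.2 u hu' huv.symm
    · by_cases huK : u ∈ K
      · exact hvS.2 u huK huv.symm
      · exact h x hx u huK v hvS.1 hux huv
  intro y hy hyK z hz hyz
  by_contra hzK
  obtain ⟨x, hx, hyx⟩ := hall y hy hyK
  exact h x hx y hyK z hzK hyx hyz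

theorem degSum_of_outside_independent (hKM : K ⊆ M)
    (h : ∀ y ∈ M, y ∉ K → ∀ z ∈ M, G.Adj y z → z ∈ K) :
    degSum G M = degSum G K + 2 * ∑ y ∈ M \ K, (nbrsIn G K y).card := by
  have key : ∀ W ⊆ M \ K,
      degSum G (W ∪ K) = degSum G K + 2 * ∑ y ∈ W, (nbrsIn G K y).card := by
    intro W
    induction W using Finset.induction_on with
    | empty => simp
    | insert y W hy ih =>
      intro hW
      have hyMK := Finset.mem_sdiff.1 (hW (Finset.mem_insert_self y W))
      have hWM : W ⊆ M \ K := (Finset.subset_insert _ _).trans hW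
      have : nbrsIn G (W ∪ K) y = nbrsIn G K y := by
        ext z
        simp only [mem_nbrsIn, Finset.mem_union]
        constructor
        · rintro ⟨hz | hz, hyz⟩
          · exact ⟨h y hyMK.1 hyMK.2 z (Finset.mem_sdiff.1 (hWM hz)).1 hyz, hyz⟩
          · exact ⟨hz, hyz⟩
        · exact fun hz => ⟨Or.inr hz.1, hz.2⟩
      rw [Finset.insert_union, degSum_insert (by simp [hy, hyMK.2]), ih hWM, this,
        Finset.sum_insert hy]
      ring
  have := key (M \ K) (Finset.Subset.refl _)
  rwa [Finset.sdiff_union_of_subset hKM] at this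

/-- A spanning path of `K` extends by two vertices in no way, so outside vertices are independent
and two of them never attach at different vertices. They send at most one edge each on average, and
42 + 2(m - 7) < 6m - 10. -/
theorem false_of_core_seven (hG : PathNineFree G) (hconn : ConnOn G M) (hM : 11 ≤ M.card)
    (hd : 6 * M.card ≤ degSum G M + 10) (hb : ThreeBuilt G M K) (hK : K.card = 7)
    (hH : HamConn G K) : False := by
  have hne : K.Nonempty := Finset.card_pos.1 (by omega)
  have hout := hconn.nbrsIn_subset_of_not_adj hb.subset hne (by
    intro x hx y hy z hz hyx hyz
    obtain ⟨a, ha⟩ := hH.exists_path_to (by omega) hx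
    have hzy : z ∉ insert y K := by simp [hz, hyz.ne']
    have := hG _ _ _ ((ha.snoc hy hyx.symm).snoc hzy hyz)
    rw [Finset.card_insert_of_notMem hzy, Finset.card_insert_of_notMem hy] at this
    omega)
  have hs := degSum_of_outside_independent hb.subset hout
  have hKd := degSum_le G K
  rw [hK] at hKd
  have hcard := Finset.card_sdiff_add_card_eq_card hb.subset
  have heq : ∀ y, y ∉ K → ∀ z, z ∉ K → y ≠ z → ∀ x ∈ K, ∀ x' ∈ K, G.Adj y x → G.Adj z x' →
      x = x' := by
    intro y hy z hz hyz x hx x' hx' hyx hzx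
    by_contra hne
    have hzy : z ∉ insert y K := by simp [hz, hyz.symm]
    have := hG _ _ _ (((hH x hx x' hx' hne).cons hy hyx).snoc hzy hzx.symm)
    rw [Finset.card_insert_of_notMem hzy, Finset.card_insert_of_notMem hy] at this
    omega
  have hsum : ∑ y ∈ M \ K, (nbrsIn G K y).card ≤ (M \ K).card := by
    -- A vertex with two neighbours in `K` leaves no possible attachment to any other; its at most
    -- three edges are fewer than the at least four outside vertices.
    by_cases h2 : ∃ y ∈ M \ K, 2 ≤ (nbrsIn G K y).card
    · obtain ⟨y, hy, h2⟩ := h2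
      have hy' := Finset.mem_sdiff.1 hy
      rw [Finset.sum_eq_single_of_mem y hy]
      · have := hb.card_nbrsIn_le hy'.1 hy'.2
        omega
      · intro z hz hzy
        rw [Finset.card_eq_zero, Finset.eq_empty_iff_forall_notMem]
        intro x' hx'
        obtain ⟨x, hx, hxx⟩ := Finset.exists_mem_ne (show 1 < (nbrsIn G K y).card by omega) x'
        rw [mem_nbrsIn] at hx hx'
        exact hxx (heq y hy'.2 z (Finset.mem_sdiff.1 hz).2 hzy.symm x hx.1 x' hx'.1 hx.2 hx'.2)
    · push Not at h2
      calc ∑ y ∈ M \ K, (nbrsIn G K y).card ≤ ∑ y ∈ M \ K, 1 :=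
            Finset.sum_le_sum fun y hy => by have := h2 y hy; omega
        _ = (M \ K).card := by simp
  omega

/-- Among three triples in a set with six elements, two have a common element. -/
theorem exists_common_neighbor {F : Finset V} (hK : K.card = 6) (hF : 3 ≤ F.card)
    (h3 : ∀ y ∈ F, (nbrsIn G K y).card = 3) :
    ∃ y ∈ F, ∃ y' ∈ F, ∃ y'' ∈ F, y ≠ y' ∧ y ≠ y'' ∧ y' ≠ y'' ∧
      ∃ a ∈ nbrsIn G K y, a ∈ nbrsIn G K y' := by
  obtain ⟨F', hF', hc⟩ := Finset.exists_subset_card_eq hF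
  obtain ⟨u, v, w, huv, huw, hvw, rfl⟩ := Finset.card_eq_three.1 hc
  have hu : u ∈ F := hF' (by simp)
  have hv : v ∈ F := hF' (by simp)
  have hw : w ∈ F := hF' (by simp)
  by_cases h1 : Disjoint (nbrsIn G K u) (nbrsIn G K v)
  · by_cases h2 : Disjoint (nbrsIn G K u ∪ nbrsIn G K v) (nbrsIn G K w)
    · have h4 : nbrsIn G K u ∪ nbrsIn G K v ∪ nbrsIn G K w ⊆ K :=
        Finset.union_subset (Finset.union_subset nbrsIn_subset nbrsIn_subset) nbrsIn_subset
      have := Finset.card_le_card h4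
      rw [Finset.card_union_of_disjoint h2, Finset.card_union_of_disjoint h1, h3 u hu, h3 v hv,
        h3 w hw] at this
      omega
    · rw [Finset.not_disjoint_iff] at h2
      obtain ⟨a, ha, haw⟩ := h2
      rcases Finset.mem_union.1 ha with ha | ha
      · exact ⟨u, hu, w, hw, v, hv, huw, huv, hvw.symm, a, ha, haw⟩
      · exact ⟨v, hv, w, hw, u, hu, hvw, huv.symm, huw.symm, a, ha, haw⟩
  · rw [Finset.not_disjoint_iff] at h1
    obtain ⟨a, ha, ha'⟩ := h1
    exact ⟨u, hu, v, hv, w, hw, huv, huw, hvw, a, ha, ha'⟩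

/-- The forbidden path is y a y' b … c y'', with 3 + 5 + 1 vertices. -/
theorem PathNineFree.no_split_path (hG : PathNineFree G) (hK : K.card = 6) {y y' y'' a b c : V}
    (hy : y ∉ K) (hy' : y' ∉ K) (hy'' : y'' ∉ K) (h1 : y ≠ y') (h2 : y ≠ y'') (h3 : y' ≠ y'')
    (ha : a ∈ K) (hya : G.Adj y a) (hya' : G.Adj y' a) (hyb : G.Adj y' b) (hyc : G.Adj y'' c) :
    ¬ PathOn G (K.erase a) b c := by
  intro hp
  have hay' : a ≠ y' := fun h => hy' (h ▸ ha)
  have n2 : a ∉ insert y' (K.erase a) := by simp [hay']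
  have e2 := ((hp.cons (x := y') (by simp [hy']) hyb).cons n2 hya'.symm)
  rw [Finset.insert_comm, Finset.insert_erase ha] at e2
  have n3 : y ∉ insert y' K := by simp [hy, h1]
  have n4 : y'' ∉ insert y (insert y' K) := by simp [hy'', h2.symm, h3.symm]
  have := hG _ _ _ ((e2.cons n3 hya).snoc n4 hyc.symm)
  rw [Finset.card_insert_of_notMem n4, Finset.card_insert_of_notMem n3,
    Finset.card_insert_of_notMem hy'] at this
  omega

theorem card_filter_three_le {W : Type*} {Y : Finset W} (f : W → ℕ) (hf : ∀ y ∈ Y, f y ≤ 3) :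
    ∑ y ∈ Y, f y ≤ 2 * Y.card + (Y.filter fun y => f y = 3).card := by
  rw [Finset.card_filter, mul_comm, ← smul_eq_mul, ← Finset.sum_const, ← Finset.sum_add_distrib]
  refine Finset.sum_le_sum fun y hy => ?_
  have := hf y hy
  split_ifs <;> omega

/-- The outside vertices are independent and at most two edges short of three each, so at least
three of them have exactly three neighbours in `K`. Two of these share a neighbour `a`, and `K`
without `a` remains Hamilton connected, which gives the path excluded by
`PathNineFree.no_split_path`. -/
theorem false_of_core_six (hG : PathNineFree G) (hconn : ConnOn G M) (hM : 11 ≤ M.card)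
    (hd : 6 * M.card ≤ degSum G M + 10) (hb : ThreeBuilt G M K) (hK : K.card = 6)
    (hdeg : ∀ v ∈ K, 4 ≤ (nbrsIn G K v).card) : False := by
  have hH : HamConn G K := hamConn_of_missing_one (by omega) fun v hv => by
    have := hdeg v hv; omega
  have hne : K.Nonempty := Finset.card_pos.1 (by omega)
  have hKd := degSum_le G K
  rw [hK] at hKd
  have hout := hconn.nbrsIn_subset_of_not_adj hb.subset hne
    fun x hx y hy z hz hyx => hH.not_adj_outside hG hK hb (by omega) (by omega) hx hy hz hyx
  have hs := degSum_of_outside_independent hb.subset hout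
  have hcard := Finset.card_sdiff_add_card_eq_card hb.subset
  have hfil := card_filter_three_le (Y := M \ K) (fun y => (nbrsIn G K y).card)
    (fun y hy => hb.card_nbrsIn_le (Finset.mem_sdiff.1 hy).1 (Finset.mem_sdiff.1 hy).2)
  obtain ⟨y, hy, y', hy', y'', hy'', n1, n2, n3, a, ha, ha'⟩ := exists_common_neighbor (G := G)
    (F := (M \ K).filter fun y => (nbrsIn G K y).card = 3) hK (by omega)
    (fun y hy => (Finset.mem_filter.1 hy).2)
  simp only [Finset.mem_filter, Finset.mem_sdiff] at hy hy' hy''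
  obtain ⟨b, hb', hba⟩ := Finset.exists_mem_ne (show 1 < (nbrsIn G K y').card by omega) a
  obtain ⟨c, hc, hcab⟩ := Finset.exists_mem_notMem_of_card_lt_card
    (show ({a, b} : Finset V).card < (nbrsIn G K y'').card from
      lt_of_le_of_lt Finset.card_le_two (by omega))
  simp only [Finset.mem_insert, Finset.mem_singleton, not_or] at hcab
  rw [mem_nbrsIn] at ha ha' hb' hc
  have hcK := Finset.card_erase_add_one ha.1
  have hHa : HamConn G (K.erase a) := hamConn_of_missing_one (by omega) fun v hv => by
    have := hdeg v (Finset.mem_of_mem_erase hv)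
    have := card_nbrsIn_le_erase (G := G) (T := K) (u := a) (v := v)
    omega
  exact hG.no_split_path hK hy.1.2 hy'.1.2 hy''.1.2 n1 n2 n3 ha.1 ha.2 ha'.2 hb'.2 hc.2
    (hHa b (by simp [hba, hb'.1]) c (by simp [hcab.1, hc.1]) (Ne.symm hcab.2))

theorem adj_of_degSum_eq {Q : Finset V} (hQ : Q.card * (Q.card - 1) ≤ degSum G Q) :
    ∀ u ∈ Q, ∀ v ∈ Q, u ≠ v → G.Adj u v := by
  intro u hu v hv huv
  by_contra h
  have h1 : ∀ w ∈ Q, (nbrsIn G Q w).card ≤ Q.card - 1 := fun w hw => by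
    have := card_nbrsIn_lt (G := G) hw; omega
  have h2 : (nbrsIn G Q u).card < Q.card - 1 := by
    have := card_nbrsIn_add_le_of_not_adj (G := G) (K := Q) (L := {u, v}) (v := u)
      (by simp [Finset.insert_subset_iff, hu, hv])
      (by simp [h])
    rw [Finset.card_pair huv] at this
    omega
  have := Finset.sum_lt_sum h1 ⟨u, hu, h2⟩
  rw [Finset.sum_const, smul_eq_mul] at this
  exact absurd hQ (not_le.2 this)

/-- The edge count forces `Q` to be complete, the next vertex `w` to have three neighbours `N` in
`Q`, and every vertex outside `K` to have exactly three neighbours in `K`. Avoiding a nine-vertex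
path then makes all these neighbourhoods equal to `N`, so a vertex of `N` is adjacent to everything.
-/
theorem exists_dominating_of_core_five {Q : Finset V} (hG : PathNineFree G) (hconn : ConnOn G M)
    (hM : 11 ≤ M.card) (hd : 6 * M.card ≤ degSum G M + 10) (hb : ThreeBuilt G M Q)
    (hQ5 : Q.card = 5) :
    degSum G M + 10 = 6 * M.card ∧ ∃ a ∈ M, ∀ v ∈ M, v ≠ a → G.Adj v a := by
  have hQd := degSum_le G Q
  rw [hQ5] at hQd
  have hbd := hb.degSum_le
  have hQ : ∀ u ∈ Q, ∀ v ∈ Q, u ≠ v → G.Adj u v := adj_of_degSum_eq (by rw [hQ5]; omega)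
  obtain ⟨w, hwM, hwQ, hbK, hKc, hKd, hw3⟩ := hb.exists_step_card (by omega)
  have hbd' := hbK.degSum_le
  have hN3 : (nbrsIn G Q w).card = 3 := by omega
  set K := insert w Q with hKdef
  set N := nbrsIn G Q w with hNdef
  have hNQ : N ⊆ Q := nbrsIn_subset
  have hNK : N ⊆ K := hNQ.trans (Finset.subset_insert _ _)
  have hK6 : K.card = 6 := by omega
  refine ⟨by omega, ?_⟩
  have hpair : ∀ x y : V, ¬ N ⊆ {x, y} := fun x y h => by
    have := (Finset.card_le_card h).trans Finset.card_le_two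
    omega
  have hH : HamConn G K := fun x hx y hy hxy =>
    PathOn.of_clique_insert hQ hwQ hx hy hxy (hN3 ▸ by norm_num) (hpair x y)
  have hne : K.Nonempty := Finset.card_pos.1 (by omega)
  have hout := hconn.nbrsIn_subset_of_not_adj hbK.subset hne
    fun x hx y hy z hz hyx => hH.not_adj_outside hG hK6 hbK (by omega) (by omega) hx hy hz hyx
  have hs := degSum_of_outside_independent hbK.subset hout
  have hcard := Finset.card_sdiff_add_card_eq_card hbK.subset
  have hfil := card_filter_three_le (Y := M \ K) (fun y => (nbrsIn G K y).card)
    (fun y hy => hbK.card_nbrsIn_le (Finset.mem_sdiff.1 hy).1 (Finset.mem_sdiff.1 hy).2)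
  have hall : ∀ y ∈ M \ K, (nbrsIn G K y).card = 3 := by
    have : (M \ K).filter (fun y => (nbrsIn G K y).card = 3) = M \ K :=
      Finset.eq_of_subset_of_card_le (Finset.filter_subset _ _) (by omega)
    intro y hy
    rw [← this] at hy
    exact (Finset.mem_filter.1 hy).2
  have hpath : ∀ a ∈ K, ∀ b ∈ K, ∀ c ∈ K, a ≠ b → a ≠ c → b ≠ c → ¬ N ⊆ {a, b, c} →
      PathOn G (K.erase a) b c := by
    intro a ha b hb c hc hab hac hbc hN
    by_cases haw : a = w
    · subst haw
      rw [hKdef, Finset.erase_insert hwQ]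
      rw [hKdef, Finset.mem_insert] at hb hc
      exact PathOn.of_clique hQ (hb.resolve_left hab.symm) (hc.resolve_left hac.symm) hbc
    · have hKa : K.erase a = insert w (Q.erase a) := by
        rw [hKdef, Finset.erase_insert_of_ne (Ne.symm haw)]
      rw [hKa]
      have hNa : nbrsIn G (Q.erase a) w = N.erase a := by
        ext z; simp only [hNdef, mem_nbrsIn, Finset.mem_erase]; tauto
      apply PathOn.of_clique_insert
        (fun u hu v hv => hQ u (Finset.mem_of_mem_erase hu) v (Finset.mem_of_mem_erase hv))
        (by simp [hwQ]) (hKa ▸ Finset.mem_erase.2 ⟨hab.symm, hb⟩)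
        (hKa ▸ Finset.mem_erase.2 ⟨hac.symm, hc⟩) hbc
      · rw [hNa]
        have := Finset.pred_card_le_card_erase (s := N) (a := a)
        omega
      · rw [hNa]
        intro h
        apply hN
        intro z hz
        by_cases hza : z = a
        · simp [hza]
        · exact Finset.mem_insert_of_mem (h (Finset.mem_erase.2 ⟨hza, hz⟩))
  -- The only obstruction to the path y a y' b … c y'' is that `w` has no neighbour in `K` outside
  -- {a, b, c}.
  have star : ∀ y ∈ M \ K, ∀ y' ∈ M \ K, ∀ y'' ∈ M \ K, y ≠ y' → y ≠ y'' → y' ≠ y'' →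
      ∀ a ∈ nbrsIn G K y, a ∈ nbrsIn G K y' → ∀ b ∈ nbrsIn G K y', ∀ c ∈ nbrsIn G K y'',
      a ≠ b → a ≠ c → b ≠ c → N = {a, b, c} := by
    intro y hy y' hy' y'' hy'' n1 n2 n3 a ha ha' b hb' c hc hab hac hbc
    rw [mem_nbrsIn] at ha ha' hb' hc
    rw [Finset.mem_sdiff] at hy hy' hy''
    have : N ⊆ {a, b, c} := by
      by_contra hN
      exact hG.no_split_path hK6 hy.2 hy'.2 hy''.2 n1 n2 n3 ha.1 ha.2 ha'.2 hb'.2 hc.2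
        (hpath a ha.1 b hb'.1 c hc.1 hab hac hbc hN)
    exact Finset.eq_of_subset_of_card_le this (by rw [hN3]; exact Finset.card_le_three)
  obtain ⟨y, hy, y', hy', y'', hy'', n1, n2, n3, a, ha, ha'⟩ := exists_common_neighbor (G := G)
    hK6 (by omega) hall
  have step : ∀ y ∈ M \ K, ∀ y' ∈ M \ K, y ≠ y' → y ≠ y'' → y' ≠ y'' →
      a ∈ nbrsIn G K y → a ∈ nbrsIn G K y' → nbrsIn G K y' = N := by
    intro y hy y' hy' n1 n2 n3 ha ha'
    have hsub : ∀ b ∈ nbrsIn G K y', b ≠ a → a ∈ N ∧ b ∈ N := by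
      intro b hb' hba
      obtain ⟨c, hc, hcab⟩ := Finset.exists_mem_notMem_of_card_lt_card
        (show ({a, b} : Finset V).card < (nbrsIn G K y'').card from
          lt_of_le_of_lt Finset.card_le_two (by rw [hall y'' hy'']; omega))
      simp only [Finset.mem_insert, Finset.mem_singleton, not_or] at hcab
      rw [star y hy y' hy' y'' hy'' n1 n2 n3 a ha ha' b hb' c hc hba.symm (Ne.symm hcab.1)
        (Ne.symm hcab.2)]
      simp
    obtain ⟨b, hb', hba⟩ := Finset.exists_mem_ne
      (show 1 < (nbrsIn G K y').card by rw [hall y' hy']; omega) a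
    refine Finset.eq_of_subset_of_card_le (fun z hz => ?_) (by rw [hN3, hall y' hy'])
    by_cases hza : z = a
    · rw [hza]; exact (hsub b hb' hba).1
    · exact (hsub z hz hza).2
  have hNy' := step y hy y' hy' n1 n2 n3 ha ha'
  have hNy := step y' hy' y hy n1.symm n3 n2 ha' ha
  have hNall : ∀ z ∈ M \ K, nbrsIn G K z = N := by
    intro z hz
    by_cases hzy : z = y
    · rw [hzy, hNy]
    by_cases hzy' : z = y'
    · rw [hzy', hNy']
    -- A neighbour `c` of `z` outside `N` could serve as the third element in `star`, putting it in
    -- `N` after all.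
    refine Finset.eq_of_subset_of_card_le (fun c hc => ?_) (by rw [hN3, hall z hz])
    by_contra hcN
    have haN : a ∈ N := hNy ▸ ha
    obtain ⟨b, hbN, hba⟩ := Finset.exists_mem_ne (show 1 < N.card by omega) a
    have := star y hy y' hy' z hz n1 (Ne.symm hzy) (Ne.symm hzy') a ha ha' b (hNy' ▸ hbN) c hc
      hba.symm (by rintro rfl; exact hcN haN) (by rintro rfl; exact hcN hbN)
    exact hcN (by rw [this]; simp)
  have haN : a ∈ N := hNy ▸ ha
  refine ⟨a, hbK.subset (hNK haN), fun v hv hva => ?_⟩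
  by_cases hvK : v ∈ K
  · rcases Finset.mem_insert.1 hvK with rfl | hvQ
    · exact (mem_nbrsIn.1 haN).2
    · exact hQ v hvQ a (hNQ haN) hva
  · have := haN
    rw [← hNall v (Finset.mem_sdiff.2 ⟨hv, hvK⟩), mem_nbrsIn] at this
    exact this.2

/-- A connected graph on `m ≥ 11` vertices without a path on nine vertices has at most `3 m - 5`
edges, and if it has that many then some vertex is adjacent to all others. -/
theorem ConnOn.exists_dominating (hG : PathNineFree G) (hconn : ConnOn G M) (hM : 11 ≤ M.card)
    (hd : 6 * M.card ≤ degSum G M + 10) :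
    degSum G M + 10 = 6 * M.card ∧ ∃ a ∈ M, ∀ v ∈ M, v ≠ a → G.Adj v a := by
  obtain ⟨T, hb, hT⟩ := hconn.exists_threeBuilt hG (by omega)
  by_cases h7 : ∀ v ∈ T, 4 ≤ (nbrsIn G T v).card
  · exact (false_of_core_seven hG hconn hM hd hb hT (hamConn_of_card_seven hT h7)).elim
  push Not at h7
  obtain ⟨u, hu, hu3⟩ := h7
  have hb6 := hb.erase hu (by omega)
  have hc6 := Finset.card_erase_add_one hu
  by_cases h6 : ∀ v ∈ T.erase u, 4 ≤ (nbrsIn G (T.erase u) v).card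
  · exact (false_of_core_six hG hconn hM hd hb6 (by omega) h6).elim
  push Not at h6
  obtain ⟨v, hv, hv3⟩ := h6
  have hc5 := Finset.card_erase_add_one hv
  exact exists_dominating_of_core_five hG hconn hM hd (hb6.erase hv (by omega)) (by omega)

end ConnectedGraphs

/-! ### Bipartite graphs without a nine-vertex path. -/

section BipartiteGraphs

variable {V : Type*} {G : SimpleGraph V}

theorem card_filter_color_add (c : V → Bool) (K : Finset V) (b : Bool) :
    (K.filter fun v => c v = b).card + (K.filter fun v => c v ≠ b).card = K.card :=
  Finset.card_filter_add_card_filter_not _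

/-- If both colour classes of `K` have at most `n` vertices, the average degree is at most `n`. -/
theorem degSum_le_of_color_classes {c : V → Bool} (hc : ∀ u v, G.Adj u v → c v = !c u)
    {K : Finset V} {b : Bool} {n : ℕ} (h1 : (K.filter fun v => c v = b).card ≤ n)
    (h2 : (K.filter fun v => c v ≠ b).card ≤ n) : degSum G K ≤ n * K.card := by
  rw [mul_comm, ← smul_eq_mul]
  refine Finset.sum_le_card_nsmul _ _ _ fun v hv => ?_
  by_cases hvb : c v = b
  · refine (Finset.card_le_card fun u hu => ?_).trans h2
    rw [mem_nbrsIn] at hu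
    rw [Finset.mem_filter, hc v u hu.2, hvb]
    exact ⟨hu.1, by simp⟩
  · refine (Finset.card_le_card fun u hu => ?_).trans h1
    rw [mem_nbrsIn] at hu
    rw [Finset.mem_filter, hc v u hu.2]
    exact ⟨hu.1, by cases hcv : c v <;> cases b <;> simp_all⟩

variable [DecidableEq V]

theorem PathOn.card_color_classes {c : V → Bool} (hc : ∀ u v, G.Adj u v → c v = !c u)
    {K : Finset V} {x y : V} (h : PathOn G K x y) :
    (K.filter fun v => c v = c x).card =
      (K.filter fun v => c v ≠ c x).card + if c x = c y then 1 else 0 := by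
  induction h with
  | single x => simp [Finset.filter_singleton]
  | @cons K x s y h hx hxs ih =>
    have hs := hc x s hxs
    have e1 : (K.filter fun v => c v = c s) = K.filter fun v => c v ≠ c x := by
      ext v; cases hv : c v <;> cases hcx : c x <;> simp_all
    have e2 : (K.filter fun v => c v ≠ c s) = K.filter fun v => c v = c x := by
      ext v; cases hv : c v <;> cases hcx : c x <;> simp_all
    rw [e1, e2] at ih
    rw [Finset.filter_insert, Finset.filter_insert, if_pos rfl, if_neg (by simp),
      Finset.card_insert_of_notMem (by simp [hx]), ih]
    cases hcx : c x <;> cases hcy : c y <;> simp_all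

theorem no_edges_sdiff {T K : Finset V}
    (h : ∀ u ∈ K, ∀ v ∈ T, v ∉ K → ¬ G.Adj u v) (hKT : K ⊆ T) :
    degSum G T = degSum G K + degSum G (T \ K) := by
  rw [← degSum_union_of_no_edges Finset.disjoint_sdiff
    (fun u hu v hv => h u hu v (Finset.mem_sdiff.1 hv).1 (Finset.mem_sdiff.1 hv).2),
    Finset.union_sdiff_of_subset hKT]

/-- In a bipartite graph, the component of a longest path with seven vertices whose ends have
degree three is a complete bipartite graph with three vertices on one side. -/
theorem exists_complete_component {c : V → Bool} (hc : ∀ u v, G.Adj u v → c v = !c u)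
    {T K : Finset V} {x y : V} (h : PathOn G K x y) (hKT : K ⊆ T)
    (hmax : ∀ K' x' y', PathOn G K' x' y' → K' ⊆ T → K'.card ≤ K.card) (hK : K.card = 7)
    (hdeg : ∀ v ∈ T, 3 ≤ (nbrsIn G T v).card) :
    ∃ X ⊆ T, X.card = 3 ∧ (∀ a ∈ X, c a = !c x) ∧
      ∀ w ∈ T, ∀ a ∈ X, G.Adj w a → nbrsIn G T w = X := by
  have k0 := Finset.card_erase_add_one h.left_mem
  obtain ⟨a₁, h₁, e01⟩ := h.tail (by omega)
  have k1 := Finset.card_erase_add_one h₁.left_mem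
  obtain ⟨b₂, h₂, e12⟩ := h₁.tail (by omega)
  have k2 := Finset.card_erase_add_one h₂.left_mem
  obtain ⟨a₂, h₃, e23⟩ := h₂.tail (by omega)
  have k3 := Finset.card_erase_add_one h₃.left_mem
  obtain ⟨b₃, h₄, e34⟩ := h₃.tail (by omega)
  have k4 := Finset.card_erase_add_one h₄.left_mem
  obtain ⟨a₃, h₅, e45⟩ := h₄.tail (by omega)
  have k5 := Finset.card_erase_add_one h₅.left_mem
  obtain ⟨b₄, h₆, e56⟩ := h₅.tail (by omega)
  have k6 := Finset.card_erase_add_one h₆.left_mem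
  obtain rfl : b₄ = y := by
    obtain ⟨a, ha⟩ := Finset.card_eq_one.1
      (show ((((((K.erase x).erase a₁).erase b₂).erase a₂).erase b₃).erase a₃).card = 1 by omega)
    have h1 := h₆.right_mem
    have h2 := h₆.left_mem
    rw [ha, Finset.mem_singleton] at h1 h2
    exact h2.trans h1.symm
  have hx := h.left_mem
  have m1 := h₁.left_mem
  have m2 := h₂.left_mem
  have m3 := h₃.left_mem
  have m4 := h₄.left_mem
  have m5 := h₅.left_mem
  have m6 := h₆.left_mem
  simp only [Finset.mem_erase] at m1 m2 m3 m4 m5 m6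
  clear h₁ h₂ h₃ h₄ h₅ h₆ k0 k1 k2 k3 k4 k5 k6
  have c1 : c a₁ = !c x := hc _ _ e01
  have c2 : c b₂ = c x := by rw [hc _ _ e12, c1, Bool.not_not]
  have c3 : c a₂ = !c x := by rw [hc _ _ e23, c2]
  have c4 : c b₃ = c x := by rw [hc _ _ e34, c3, Bool.not_not]
  have c5 : c a₃ = !c x := by rw [hc _ _ e45, c4]
  have c6 : c b₄ = c x := by rw [hc _ _ e56, c5, Bool.not_not]
  have hXc : ({a₁, a₂, a₃} : Finset V).card = 3 := by
    rw [Finset.card_eq_three]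
    exact ⟨a₁, a₂, a₃, m3.2.1.symm, m5.2.2.2.1.symm, m5.2.1.symm, rfl⟩
  have hneq : ∀ u v, c u = !c x → c v = c x → u ≠ v := by
    rintro u v hu hv rfl
    rw [hu] at hv
    cases hcx : c x <;> simp_all
  -- The start of any path of this shape has no neighbours besides `a₁`, `a₂`, `a₃`.
  have start : ∀ w p q r a a' a'' : V, w ∈ T → p ∈ T → q ∈ T → r ∈ T → c w = c x → c p = c x →
      c q = c x → c r = c x → [w, p, q, r].Nodup → [a, a', a''].Nodup →
      ({a, a', a''} : Finset V) = {a₁, a₂, a₃} →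
      [w, a, p, a', q, a'', r].IsChain G.Adj → nbrsIn G T w = {a₁, a₂, a₃} := by
    intro w p q r a a' a'' hw hp hq hr cw cp cq cr hn hn' hX hch
    have hsub : ∀ z ∈ ({a, a', a''} : Finset V), c z = !c x ∧ z ∈ T := by
      intro z hz
      rw [hX] at hz
      simp only [Finset.mem_insert, Finset.mem_singleton] at hz
      rcases hz with rfl | rfl | rfl
      exacts [⟨c1, hKT m1.2⟩, ⟨c3, hKT m3.2.2.2⟩, ⟨c5, hKT m5.2.2.2.2.2⟩]
    have ha := hsub a (by simp)
    have ha' := hsub a' (by simp)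
    have ha'' := hsub a'' (by simp)
    have hnd : [w, a, p, a', q, a'', r].Nodup := by
      have n1 := fun v hv => hneq a v ha.1 hv
      have n2 := fun v hv => hneq a' v ha'.1 hv
      have n3 := fun v hv => hneq a'' v ha''.1 hv
      simp only [List.nodup_cons, List.mem_cons, List.not_mem_nil, or_false, not_or,
        not_false_eq_true, List.nodup_nil, and_true] at hn hn' ⊢
      exact ⟨⟨(n1 w cw).symm, hn.1.1, (n2 w cw).symm, hn.1.2.1, (n3 w cw).symm, hn.1.2.2⟩,
        ⟨n1 p cp, hn'.1.1, n1 q cq, hn'.1.2, n1 r cr⟩,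
        ⟨(n2 p cp).symm, hn.2.1.1, (n3 p cp).symm, hn.2.1.2⟩,
        ⟨n2 q cq, hn'.2, n2 r cr⟩, ⟨(n3 q cq).symm, hn.2.2⟩, n3 r cr⟩
    obtain ⟨z, hz⟩ := PathOn.of_list w _ hch hnd
    have hcard : ([w, a, p, a', q, a'', r].toFinset).card = 7 := List.toFinset_card_of_nodup hnd
    have hT : [w, a, p, a', q, a'', r].toFinset ⊆ T := by
      intro v hv
      simp only [List.mem_toFinset, List.mem_cons, List.not_mem_nil, or_false] at hv
      rcases hv with rfl | rfl | rfl | rfl | rfl | rfl | rfl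
      exacts [hw, ha.2, hp, ha'.2, hq, ha''.2, hr]
    -- The new path also has seven vertices, so it is longest too: its start has neighbours only on
    -- it, of the opposite colour, and at least three of them.
    have hnb := nbrsIn_subset_of_longest hz hT (by rw [hcard, ← hK]; exact hmax)
    refine Finset.eq_of_subset_of_card_le (fun v hv => ?_) (by rw [hXc]; exact hdeg w hw)
    have hcv := hc _ _ (mem_nbrsIn.1 hv).2
    rw [cw] at hcv
    have hv' := hnb hv
    simp only [List.mem_toFinset, List.mem_cons, List.not_mem_nil, or_false] at hv'
    rw [← hX]
    rcases hv' with rfl | rfl | rfl | rfl | rfl | rfl | rfl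
    · exact absurd rfl (hneq _ _ hcv cw)
    · simp
    · exact absurd rfl (hneq _ _ hcv cp)
    · simp
    · exact absurd rfl (hneq _ _ hcv cq)
    · simp
    · exact absurd rfl (hneq _ _ hcv cr)
  have tx := hKT hx
  have t2 := hKT m2.2.2
  have t4 := hKT m4.2.2.2.2
  have t6 := hKT m6.2.2.2.2.2.2
  have nX : [a₁, a₂, a₃].Nodup := by
    simp [m3.2.1.symm, m5.2.2.2.1.symm, m5.2.1.symm]
  have nX' : [a₃, a₂, a₁].Nodup := by simp [m3.2.1, m5.2.2.2.1, m5.2.1]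
  have nX'' : [a₂, a₁, a₃].Nodup := by simp [m3.2.1, m5.2.2.2.1.symm, m5.2.1.symm]
  have eX' : ({a₃, a₂, a₁} : Finset V) = {a₁, a₂, a₃} := by ext; simp; tauto
  have eX'' : ({a₂, a₁, a₃} : Finset V) = {a₁, a₂, a₃} := by ext; simp; tauto
  obtain ⟨m21, m2x, -⟩ := m2
  obtain ⟨m43, m42, m41, m4x, -⟩ := m4
  obtain ⟨m65, m64, m63, m62, m61, m6x, -⟩ := m6
  have Nx : nbrsIn G T x = {a₁, a₂, a₃} := start x b₂ b₃ b₄ a₁ a₂ a₃ tx t2 t4 t6 rfl c2 c4 c6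
    (by simp [m2x.symm, m4x.symm, m6x.symm, m42.symm, m62.symm, m64.symm]) nX rfl
    (by simp [e01, e12, e23, e34, e45, e56])
  have N4 : nbrsIn G T b₄ = {a₁, a₂, a₃} := start b₄ b₃ b₂ x a₃ a₂ a₁ t6 t4 t2 tx c6 c4 c2 rfl
    (by simp [m2x, m4x, m6x, m42, m62, m64]) nX' eX'
    (by simp [e01.symm, e12.symm, e23.symm, e34.symm, e45.symm, e56.symm])
  have ex : ∀ a ∈ ({a₁, a₂, a₃} : Finset V), G.Adj x a := fun a ha =>
    (mem_nbrsIn.1 (Nx ▸ ha : a ∈ nbrsIn G T x)).2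
  have e4 : ∀ a ∈ ({a₁, a₂, a₃} : Finset V), G.Adj b₄ a := fun a ha =>
    (mem_nbrsIn.1 (N4 ▸ ha : a ∈ nbrsIn G T b₄)).2
  have ex2 := ex a₂ (by simp)
  have ex3 := ex a₃ (by simp)
  have e41 := e4 a₁ (by simp)
  have e42 := e4 a₂ (by simp)
  refine ⟨{a₁, a₂, a₃}, Nx ▸ nbrsIn_subset, hXc, ?_, ?_⟩
  · intro a ha
    exact hc _ _ (ex a ha)
  · intro w hw a ha hwa
    -- Whatever its position, `w` can be made the first vertex of a path of the same shape, using
    -- the extra edges at `x` and `b₄`.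
    have hcw : c w = c x := by rw [hc _ _ hwa.symm, hc _ _ (ex a ha), Bool.not_not]
    by_cases hwx : w = x
    · rw [hwx, Nx]
    by_cases hw4 : w = b₄
    · rw [hw4, N4]
    by_cases hw2 : w = b₂
    · subst hw2
      exact start w x b₃ b₄ a₁ a₂ a₃ hw tx t4 t6 hcw rfl c4 c6
        (by simp [m2x, m4x.symm, m6x.symm, m42.symm, m62.symm, m64.symm]) nX rfl
        (by simp [e12.symm, e01.symm, ex2, e34, e45, e56])
    by_cases hw3 : w = b₃
    · subst hw3
      exact start w b₄ b₂ x a₃ a₂ a₁ hw t6 t2 tx hcw c6 c2 rfl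
        (by simp [m64.symm, m42, m4x, m62, m6x, m2x]) nX' eX'
        (by simp [e45, e56, e42, e23.symm, e12.symm, e01.symm])
    simp only [Finset.mem_insert, Finset.mem_singleton] at ha
    rcases ha with rfl | rfl | rfl
    · exact start w b₂ b₃ b₄ a a₂ a₃ hw t2 t4 t6 hcw c2 c4 c6
        (by simp [hw2, hw3, hw4, m42.symm, m62.symm, m64.symm]) nX rfl
        (by simp [hwa, e12, e23, e34, e45, e56])
    · exact start w b₂ x b₄ a a₁ a₃ hw t2 tx t6 hcw c2 rfl c6
        (by simp [hw2, hwx, hw4, m2x, m62.symm, m6x.symm]) nX'' eX''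
        (by simp [hwa, e23.symm, e12.symm, e01.symm, ex3, e56])
    · exact start w b₃ b₂ x a a₂ a₁ hw t4 t2 tx hcw c4 c2 rfl
        (by simp [hw2, hw3, hwx, m42, m4x, m2x]) nX' eX'
        (by simp [hwa, e45.symm, e34.symm, e23.symm, e12.symm, e01.symm])

/-- A bipartite graph without a path on nine vertices and without a `K_{3,7}` has at most twice
as many edges as vertices. -/
theorem degSum_le_of_bipartite (hG : PathNineFree G) {c : V → Bool}
    (hc : ∀ u v, G.Adj u v → c v = !c u)
    (hno : ∀ X N : Finset V, X.card = 3 → N.card = 7 → ∃ x ∈ X, ∃ n ∈ N, ¬ G.Adj n x)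
    (T : Finset V) : degSum G T ≤ 4 * T.card := by
  induction T using Finset.strongInduction with
  | H T ih =>
    rcases T.eq_empty_or_nonempty with rfl | hT
    · simp [degSum]
    by_cases h2 : ∃ v ∈ T, (nbrsIn G T v).card ≤ 2
    · obtain ⟨v, hv, hv2⟩ := h2
      have := ih _ (Finset.erase_ssubset hv)
      have := Finset.card_erase_add_one hv
      rw [degSum_erase hv]
      omega
    push Not at h2
    obtain ⟨K, x, y, h, hKT, hmax⟩ := exists_longest_path (G := G) hT
    have hx := nbrsIn_subset_of_longest h hKT hmax
    have hy := nbrsIn_subset_of_longest h.symm hKT hmax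
    have hx3 := h2 x (hKT h.left_mem)
    have hy3 := h2 y (hKT h.right_mem)
    have hK8 := hG _ _ _ h
    have hcl := h.card_color_classes hc
    have hcl' := card_filter_color_add c K (c x)
    -- A set without outgoing edges that satisfies the bound can be removed.
    have remove : ∀ C ⊆ T, C.Nonempty → (∀ u ∈ C, ∀ v ∈ T, v ∉ C → ¬ G.Adj u v) →
        degSum G C ≤ 4 * C.card → degSum G T ≤ 4 * T.card := by
      intro C hCT hC hout hdC
      have := ih (T \ C) (Finset.sdiff_ssubset hCT hC)
      have := Finset.card_sdiff_add_card_eq_card hCT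
      rw [no_edges_sdiff hout hCT]
      omega
    by_cases hcxy : c x = c y
    · rw [if_pos hcxy] at hcl
      -- Three neighbours of `x` lie in the smaller class of an odd path with at most 8 vertices, so
      -- the path has exactly seven.
      have hsub : nbrsIn G T x ⊆ K.filter fun v => c v ≠ c x := fun v hv =>
        Finset.mem_filter.2 ⟨hx hv, by rw [hc _ _ (mem_nbrsIn.1 hv).2]; simp⟩
      have := Finset.card_le_card hsub
      obtain ⟨X, hXT, hX3, hXc, hX⟩ :=
        exists_complete_component hc h hKT hmax (by omega) (fun v hv => h2 v hv)
      have hXne : X.Nonempty := Finset.card_pos.1 (by omega)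
      classical
      set N := T.filter fun w => ∃ a ∈ X, G.Adj w a with hN
      have hNX : ∀ w ∈ N, nbrsIn G T w = X := fun w hw => by
        obtain ⟨hwT, a, ha, hwa⟩ := Finset.mem_filter.1 hw
        exact hX w hwT a ha hwa
      have hXN : ∀ a ∈ X, ∀ w ∈ T, G.Adj a w → w ∈ N := fun a ha w hw haw =>
        Finset.mem_filter.2 ⟨hw, a, ha, haw.symm⟩
      have hN6 : N.card ≤ 6 := by
        by_contra! h7
        obtain ⟨N', hN', hc7⟩ := Finset.exists_subset_card_eq (show 7 ≤ N.card from h7)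
        obtain ⟨a, ha, n, hn, han⟩ := hno X N' hX3 hc7
        have := hNX n (hN' hn)
        rw [← this, mem_nbrsIn] at ha
        exact han ha.2
      have hdisj : Disjoint X N := by
        rw [Finset.disjoint_left]
        intro a ha haN
        obtain ⟨-, b, hb, hab⟩ := Finset.mem_filter.1 haN
        have := hc _ _ hab
        rw [hXc a ha, hXc b hb] at this
        simp at this
      have hCT : X ∪ N ⊆ T := Finset.union_subset hXT (Finset.filter_subset _ _)
      refine remove (X ∪ N) hCT (hXne.mono Finset.subset_union_left) ?_ ?_
      · intro u hu v hv hvC huv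
        rw [Finset.mem_union, not_or] at hvC
        rcases Finset.mem_union.1 hu with hu | hu
        · exact hvC.2 (hXN u hu v hv huv)
        · exact hvC.1 (hNX u hu ▸ mem_nbrsIn.2 ⟨hv, huv⟩)
      -- With n = |N| the component has 3n edges, and 6n ≤ 4(n + 3) exactly when n ≤ 6.
      · rw [degSum, Finset.sum_union hdisj, Finset.card_union_of_disjoint hdisj]
        have s1 : ∑ a ∈ X, (nbrsIn G (X ∪ N) a).card ≤ X.card • N.card :=
          Finset.sum_le_card_nsmul _ _ _ fun a ha => Finset.card_le_card fun v hv =>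
            hXN a ha v (hCT (mem_nbrsIn.1 hv).1) (mem_nbrsIn.1 hv).2
        have s2 : ∑ w ∈ N, (nbrsIn G (X ∪ N) w).card ≤ N.card • 3 :=
          Finset.sum_le_card_nsmul _ _ _ fun w hw => by
            rw [← hX3]
            exact (Finset.card_le_card (nbrsIn_mono hCT w)).trans_eq (by rw [hNX w hw])
        rw [hX3, smul_eq_mul] at s1
        rw [smul_eq_mul] at s2
        omega
    · rw [if_neg hcxy] at hcl
      have hS : nbrsIn G T y ⊆ K.filter fun v => c v = c x := fun v hv =>
        Finset.mem_filter.2 ⟨hy hv, by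
          rw [hc _ _ (mem_nbrsIn.1 hv).2]; cases hcx : c x <;> cases hcy : c y <;> simp_all⟩
      -- Predecessors of neighbours of `x` have the colour of `x`, a class of at most four vertices,
      -- fewer than 3 + 3. The path therefore closes to a cycle and is a union of components with
      -- classes of size at most four.
      obtain ⟨x', y', hcyc⟩ := h.exists_cycOn (A := nbrsIn G T x) (B := nbrsIn G T y)
        (S := K.filter fun v => c v = c x) (fun a ha => ⟨hx ha, (mem_nbrsIn.1 ha).2⟩)
        (fun a ha => ⟨hy ha, (mem_nbrsIn.1 ha).2⟩) hS
        (fun u hu v hv huv _ => Finset.mem_filter.2 ⟨hu, by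
          rw [hc _ _ huv.symm, hc _ _ (mem_nbrsIn.1 hv).2, Bool.not_not]⟩) (by omega)
      exact remove K hKT ⟨x, h.left_mem⟩ (hcyc.no_edges hKT hmax)
        (degSum_le_of_color_classes hc (b := c x) (by omega) (by omega))

end BipartiteGraphs

/-! ### Two-coloured balanced cuts, and connectedness of a dense colour. -/

section TwoColoredBipartite

variable {V : Type*}

/-- The edges of `G` between `S` and its complement. -/
def crossGraph (G : SimpleGraph V) (S : Finset V) : SimpleGraph V where
  Adj u v := G.Adj u v ∧ ¬ (u ∈ S ↔ v ∈ S)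
  symm := ⟨fun _ _ h => ⟨h.1.symm, fun h' => h.2 h'.symm⟩⟩
  loopless := ⟨fun _ h => h.2 Iff.rfl⟩

theorem crossGraph_le (G : SimpleGraph V) (S : Finset V) : crossGraph G S ≤ G :=
  fun _ _ h => h.1

variable [DecidableEq V]

/-- A red `K_{3,7}` forces a path on nine vertices. -/
theorem false_of_complete_three_seven {R B : SimpleGraph V} (hR : PathNineFree R)
    (hB : PathNineFree B) {P X N : Finset V} (hP : 7 ≤ P.card) (hX3 : X.card = 3)
    (hN7 : N.card = 7) (hXP : X ⊆ P) (hNP : ∀ n ∈ N, n ∉ P)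
    (hXN : ∀ x ∈ X, ∀ n ∈ N, R.Adj n x) (hRB : ∀ z ∈ P, ∀ n ∈ N, R.Adj z n ∨ B.Adj z n) :
    False := by
  have hne : ∀ z ∈ P, ∀ n ∈ N, z ≠ n := fun z hz n hn h => hNP n hn (h ▸ hz)
  have pick : ∀ A : Finset V, A.card ≤ 6 → ∃ n ∈ N, n ∉ A := fun A hA =>
    Finset.exists_mem_notMem_of_card_lt_card (by omega)
  -- Two red neighbours would let `z` act as a fourth vertex opposite `N`, giving an alternating red
  -- path with five vertices of `N`.
  have hbad : ∀ z ∈ P, z ∉ X → (nbrsIn R N z).card ≤ 1 := by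
    intro z hz hzX
    by_contra! h1
    obtain ⟨n₁, hn₁, n₂, hn₂, hn⟩ := Finset.one_lt_card.1 h1
    rw [mem_nbrsIn] at hn₁ hn₂
    obtain ⟨x₁, x₂, x₃, h12, h13, h23, rfl⟩ := Finset.card_eq_three.1 hX3
    obtain ⟨n₃, hn₃, h3⟩ := pick {n₁, n₂} (Finset.card_le_two.trans (by norm_num))
    obtain ⟨n₄, hn₄, h4⟩ := pick {n₁, n₂, n₃} (Finset.card_le_three.trans (by norm_num))
    obtain ⟨n₅, hn₅, h5⟩ := pick {n₁, n₂, n₃, n₄} (Finset.card_le_four.trans (by norm_num))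
    simp only [Finset.mem_insert, Finset.mem_singleton, not_or] at h3 h4 h5 hzX
    have m1 : x₁ ∈ ({x₁, x₂, x₃} : Finset V) := by simp
    have m2 : x₂ ∈ ({x₁, x₂, x₃} : Finset V) := by simp
    have m3 : x₃ ∈ ({x₁, x₂, x₃} : Finset V) := by simp
    have q1 := hne x₁ (hXP m1)
    have q2 := hne x₂ (hXP m2)
    have q3 := hne x₃ (hXP m3)
    have qz := hne z hz
    have := hR.length_le [n₃, x₁, n₁, z, n₂, x₂, n₄, x₃, n₅]
      (by simp [hXN x₁ m1 n₃ hn₃, (hXN x₁ m1 n₁ hn₁.1).symm, hn₁.2.symm, hn₂.2,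
            hXN x₂ m2 n₂ hn₂.1, (hXN x₂ m2 n₄ hn₄).symm, hXN x₃ m3 n₄ hn₄,
            (hXN x₃ m3 n₅ hn₅).symm])
      (by simp [(q1 n₃ hn₃).symm, h3, (qz n₃ hn₃).symm, (q2 n₃ hn₃).symm, Ne.symm h4.2.2,
            (q3 n₃ hn₃).symm, Ne.symm h5.2.2.1, q1 n₁ hn₁.1, Ne.symm hzX.1, q1 n₂ hn₂.1, h12,
            q1 n₄ hn₄, h13, q1 n₅ hn₅, (qz n₁ hn₁.1).symm, hn, (q2 n₁ hn₁.1).symm,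
            Ne.symm h4.1, (q3 n₁ hn₁.1).symm, Ne.symm h5.1, qz n₂ hn₂.1, hzX, qz n₄ hn₄,
            qz n₅ hn₅, (q2 n₂ hn₂.1).symm, Ne.symm h4.2.1, (q3 n₂ hn₂.1).symm,
            Ne.symm h5.2.1, q2 n₄ hn₄, h23, q2 n₅ hn₅, (q3 n₄ hn₄).symm, Ne.symm h5.2.2.2,
            q3 n₅ hn₅])
    simp at this
  have hZ := Finset.card_sdiff_add_card_eq_card hXP
  have pickZ : ∀ A : Finset V, A.card ≤ 3 → ∃ z ∈ P \ X, z ∉ A := fun A hA =>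
    Finset.exists_mem_notMem_of_card_lt_card (by omega)
  obtain ⟨z₁, hz₁, -⟩ := pickZ ∅ (by simp)
  obtain ⟨z₂, hz₂, h2⟩ := pickZ {z₁} (by simp)
  obtain ⟨z₃, hz₃, h3⟩ := pickZ {z₁, z₂} (Finset.card_le_two.trans (by norm_num))
  obtain ⟨z₄, hz₄, h4⟩ := pickZ {z₁, z₂, z₃} Finset.card_le_three
  rw [Finset.mem_sdiff] at hz₁ hz₂ hz₃ hz₄
  have b1 := hbad z₁ hz₁.1 hz₁.2
  have b2 := hbad z₂ hz₂.1 hz₂.2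
  have b3 := hbad z₃ hz₃.1 hz₃.2
  have b4 := hbad z₄ hz₄.1 hz₄.2
  -- Four vertices of `P` outside `X` each miss at most one vertex of `N` in blue, so an alternating
  -- blue path with five of the seven vertices of `N` can be chosen greedily.
  have hBadj : ∀ z ∈ P, ∀ n ∈ N, n ∉ nbrsIn R N z → B.Adj z n := fun z hz n hn h =>
    (hRB z hz n hn).resolve_left fun h' => h (mem_nbrsIn.2 ⟨hn, h'⟩)
  obtain ⟨n₁, hn₁, k1⟩ := pick (nbrsIn R N z₁ ∪ nbrsIn R N z₂)
    ((Finset.card_union_le _ _).trans (by omega))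
  obtain ⟨n₂, hn₂, k2⟩ := pick (nbrsIn R N z₂ ∪ nbrsIn R N z₃ ∪ {n₁})
    ((Finset.card_union_le _ _).trans (by
      have := Finset.card_union_le (nbrsIn R N z₂) (nbrsIn R N z₃)
      have := Finset.card_singleton n₁
      omega))
  obtain ⟨n₃, hn₃, k3⟩ := pick (nbrsIn R N z₃ ∪ nbrsIn R N z₄ ∪ {n₁, n₂})
    ((Finset.card_union_le _ _).trans (by
      have := Finset.card_union_le (nbrsIn R N z₃) (nbrsIn R N z₄)
      have := Finset.card_le_two (a := n₁) (b := n₂)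
      omega))
  obtain ⟨n₀, hn₀, k0⟩ := pick (nbrsIn R N z₁ ∪ {n₁, n₂, n₃})
    ((Finset.card_union_le _ _).trans (by
      have := Finset.card_le_three (a := n₁) (b := n₂) (c := n₃)
      omega))
  obtain ⟨n₄, hn₄, k4⟩ := pick (nbrsIn R N z₄ ∪ {n₀, n₁, n₂, n₃})
    ((Finset.card_union_le _ _).trans (by
      have := Finset.card_le_four (a := n₀) (b := n₁) (c := n₂) (d := n₃)
      omega))
  simp only [Finset.mem_union, Finset.mem_insert, Finset.mem_singleton, not_or]
    at h2 h3 h4 k0 k1 k2 k3 k4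
  have q1 := hne z₁ hz₁.1
  have q2 := hne z₂ hz₂.1
  have q3 := hne z₃ hz₃.1
  have q4 := hne z₄ hz₄.1
  have := hB.length_le [n₀, z₁, n₁, z₂, n₂, z₃, n₃, z₄, n₄]
    (by simp [(hBadj z₁ hz₁.1 n₀ hn₀ k0.1).symm, hBadj z₁ hz₁.1 n₁ hn₁ k1.1,
          (hBadj z₂ hz₂.1 n₁ hn₁ k1.2).symm, hBadj z₂ hz₂.1 n₂ hn₂ k2.1.1,
          (hBadj z₃ hz₃.1 n₂ hn₂ k2.1.2).symm, hBadj z₃ hz₃.1 n₃ hn₃ k3.1.1,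
          (hBadj z₄ hz₄.1 n₃ hn₃ k3.1.2).symm, hBadj z₄ hz₄.1 n₄ hn₄ k4.1])
    (by simp [(q1 n₀ hn₀).symm, k0, (q2 n₀ hn₀).symm, (q3 n₀ hn₀).symm, (q4 n₀ hn₀).symm,
          Ne.symm k4.2.1, q1 n₁ hn₁, Ne.symm h2, q1 n₂ hn₂, Ne.symm h3.1, q1 n₃ hn₃,
          Ne.symm h4.1, q1 n₄ hn₄, (q2 n₁ hn₁).symm, Ne.symm k2.2, (q3 n₁ hn₁).symm,
          Ne.symm k3.2.1, (q4 n₁ hn₁).symm, Ne.symm k4.2.2.1, q2 n₂ hn₂, Ne.symm h3.2,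
          q2 n₃ hn₃, Ne.symm h4.2.1, q2 n₄ hn₄, (q3 n₂ hn₂).symm, Ne.symm k3.2.2,
          (q4 n₂ hn₂).symm, Ne.symm k4.2.2.2.1, q3 n₃ hn₃, Ne.symm h4.2.2, q3 n₄ hn₄,
          (q4 n₃ hn₃).symm, Ne.symm k4.2.2.2.2, q4 n₄ hn₄])
  simp at this

variable [Fintype V]

theorem degSum_crossGraph_le (hV : Fintype.card V = 17) {R B : SimpleGraph V}
    (hR : PathNineFree R) (hB : PathNineFree B) {S : Finset V} (h7 : 7 ≤ S.card)
    (h10 : S.card ≤ 10) (hRB : ∀ u ∈ S, ∀ v, v ∉ S → R.Adj u v ∨ B.Adj u v) :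
    degSum (crossGraph R S) Finset.univ ≤ 68 := by
  have hRB' : ∀ u v, ¬ (u ∈ S ↔ v ∈ S) → R.Adj u v ∨ B.Adj u v := by
    intro u v huv
    by_cases hu : u ∈ S
    · exact hRB u hu v (by tauto)
    · exact (hRB v (by tauto) u hu).imp (·.symm) (·.symm)
  by_contra! h
  have hcard : (Finset.univ : Finset V).card = 17 := by rw [Finset.card_univ, hV]
  have hS := Finset.card_compl_add_card S
  have hno : ¬ ∀ X N : Finset V, X.card = 3 → N.card = 7 →
      ∃ x ∈ X, ∃ n ∈ N, ¬ (crossGraph R S).Adj n x := fun hno => by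
    have := degSum_le_of_bipartite (hR.mono (crossGraph_le R S)) (c := fun v => decide (v ∈ S))
      (fun u v huv => by
        have := huv.2
        by_cases hu : u ∈ S <;> by_cases hv : v ∈ S <;> simp_all) hno Finset.univ
    omega
  push Not at hno
  obtain ⟨X, N, hX3, hN7, hXN⟩ := hno
  obtain ⟨n, hn⟩ : N.Nonempty := Finset.card_pos.1 (by omega)
  obtain ⟨x, hx⟩ : X.Nonempty := Finset.card_pos.1 (by omega)
  have hXn : ∀ x ∈ X, ¬ (n ∈ S ↔ x ∈ S) := fun x hx => (hXN x hx n hn).2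
  have hNx : ∀ n ∈ N, ¬ (n ∈ S ↔ x ∈ S) := fun n hn => (hXN x hx n hn).2
  by_cases hxS : x ∈ S
  · refine false_of_complete_three_seven hR hB h7 hX3 hN7 ?_ ?_ (fun x hx n hn => (hXN x hx n hn).1)
      (fun z hz n hn => hRB' z n ?_)
    · intro x' hx'
      have := hXn x' hx'; have := hNx n hn
      tauto
    · intro n' hn'
      have := hNx n' hn'
      tauto
    · have := hNx n hn
      tauto
  · refine false_of_complete_three_seven (P := Sᶜ) hR hB (by omega) hX3 hN7 ?_ ?_
      (fun x hx n hn => (hXN x hx n hn).1) (fun z hz n hn => hRB' z n ?_)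
    · intro x' hx'
      have := hXn x' hx'; have := hNx n hn
      rw [Finset.mem_compl]
      tauto
    · intro n' hn'
      have := hNx n' hn'
      rw [Finset.mem_compl]
      tauto
    · have := hNx n hn
      rw [Finset.mem_compl] at hz
      tauto

/-- If all edges between `S` and its complement are red or blue, where `S` is balanced in a set of
`17` vertices, then there is a monochromatic path on nine vertices. -/
theorem false_of_balanced_cut (hV : Fintype.card V = 17) {R B : SimpleGraph V}
    (hR : PathNineFree R) (hB : PathNineFree B) {S : Finset V} (h7 : 7 ≤ S.card)
    (h10 : S.card ≤ 10) (hRB : ∀ u ∈ S, ∀ v, v ∉ S → R.Adj u v ∨ B.Adj u v) : False := by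
  have d1 := degSum_crossGraph_le hV hR hB h7 h10 hRB
  have d2 := degSum_crossGraph_le hV hB hR h7 h10 fun u hu v hv => (hRB u hu v hv).symm
  have hS := Finset.card_compl_add_card S
  have key : ∀ u : V, ∀ T : Finset V,
      (∀ v ∈ T, (crossGraph R S).Adj u v ∨ (crossGraph B S).Adj u v) →
      T.card ≤ (nbrsIn (crossGraph R S) Finset.univ u).card +
        (nbrsIn (crossGraph B S) Finset.univ u).card := by
    intro u T hT
    refine (Finset.card_le_card fun v hv => ?_).trans (Finset.card_union_le _ _)
    rw [Finset.mem_union, mem_nbrsIn, mem_nbrsIn]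
    exact (hT v hv).imp (fun h => ⟨Finset.mem_univ _, h⟩) (fun h => ⟨Finset.mem_univ _, h⟩)
  have s1 : ∑ u ∈ S, Sᶜ.card ≤ ∑ u ∈ S, ((nbrsIn (crossGraph R S) Finset.univ u).card +
      (nbrsIn (crossGraph B S) Finset.univ u).card) :=
    Finset.sum_le_sum fun u hu => key u Sᶜ fun v hv => by
      rw [Finset.mem_compl] at hv
      exact (hRB u hu v hv).imp (fun h => ⟨h, by tauto⟩) (fun h => ⟨h, by tauto⟩)
  have s2 : ∑ u ∈ Sᶜ, S.card ≤ ∑ u ∈ Sᶜ, ((nbrsIn (crossGraph R S) Finset.univ u).card +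
      (nbrsIn (crossGraph B S) Finset.univ u).card) :=
    Finset.sum_le_sum fun u hu => key u S fun v hv => by
      rw [Finset.mem_compl] at hu
      exact (hRB v hv u hu).imp (fun h => ⟨h.symm, by tauto⟩) (fun h => ⟨h.symm, by tauto⟩)
  have s3 := add_le_add s1 s2
  rw [Finset.sum_add_sum_compl, Finset.sum_add_distrib] at s3
  change _ ≤ degSum _ _ + degSum _ _ at s3
  rw [Finset.sum_const, Finset.sum_const, smul_eq_mul, smul_eq_mul,
    show Sᶜ.card = 17 - S.card by omega] at s3
  -- The two degree sums total at least 2s(17 - s) ≥ 140 but at most 68 + 68 = 136.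
  generalize S.card = s at *
  interval_cases s <;> omega

/-- A graph on `17` vertices with at least `45` edges and without a path on nine vertices is
connected, unless some balanced cut has no edges. -/
theorem connOn_univ_of_degSum (hV : Fintype.card V = 17) {G : SimpleGraph V}
    (hG : PathNineFree G)
    (hcut : ∀ S : Finset V, 7 ≤ S.card → S.card ≤ 10 → ∃ u ∈ S, ∃ v, v ∉ S ∧ G.Adj u v)
    (hd : 90 ≤ degSum G Finset.univ) : ConnOn G Finset.univ := by
  by_contra hconn
  have hclosed : ∀ S : Finset V, (∀ u ∈ S, ∀ v, v ∉ S → ¬ G.Adj u v) →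
      S.card ≤ 6 ∨ 11 ≤ S.card := by
    intro S hS
    by_contra! h
    obtain ⟨u, hu, v, hv, huv⟩ := hcut S (by omega) (by omega)
    exact hS u hu v hv huv
  have hcompl : ∀ S : Finset V, S.card + Sᶜ.card = 17 := fun S => by
    rw [Finset.card_add_card_compl, hV]
  -- A largest nonempty set with no outgoing edges and at most six vertices. Any larger set without
  -- outgoing edges has at least 11.
  obtain ⟨S, ⟨hSne, hS, hS6⟩, hmax⟩ : ∃ S : Finset V,
      (S.Nonempty ∧ (∀ u ∈ S, ∀ v, v ∉ S → ¬ G.Adj u v) ∧ S.card ≤ 6) ∧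
      ∀ S' : Finset V, (S'.Nonempty ∧ (∀ u ∈ S', ∀ v, v ∉ S' → ¬ G.Adj u v) ∧ S'.card ≤ 6) →
        S'.card ≤ S.card := by
    classical
    have hne : (Finset.univ.filter fun S : Finset V =>
        S.Nonempty ∧ (∀ u ∈ S, ∀ v, v ∉ S → ¬ G.Adj u v) ∧ S.card ≤ 6).Nonempty := by
      unfold ConnOn at hconn
      push Not at hconn
      obtain ⟨S, -, hne, hSu, hS⟩ := hconn
      have hS : ∀ u ∈ S, ∀ v, v ∉ S → ¬ G.Adj u v := fun u hu v hv =>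
        hS u hu v (Finset.mem_univ v) hv
      rcases hclosed S hS with h | h
      · exact ⟨S, by simpa using ⟨hne, hS, h⟩⟩
      · have := hcompl S
        refine ⟨Sᶜ, ?_⟩
        rw [Finset.mem_filter]
        refine ⟨Finset.mem_univ _, ?_, ?_, by omega⟩
        · rw [Finset.nonempty_iff_ne_empty, Ne, Finset.compl_eq_empty_iff]
          exact hSu
        · intro u hu v hv huv
          rw [Finset.mem_compl] at hu hv
          exact hS v (not_not.1 hv) u hu huv.symm
    obtain ⟨S, hS, hmax⟩ := Finset.exists_max_image _ Finset.card hne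
    simp only [Finset.mem_filter, Finset.mem_univ, true_and] at hS hmax
    exact ⟨S, hS, hmax⟩
  have hs := hcompl S
  have hs0 := hSne.card_pos
  have hsplit := no_edges_sdiff (G := G) (T := Finset.univ) (K := S)
    (fun u hu v _ hv => hS u hu v hv) (Finset.subset_univ S)
  rw [← Finset.compl_eq_univ_sdiff] at hsplit
  have five : ∀ T : Finset V, T.card ≤ 6 → degSum G T ≤ 5 * T.card := fun T hT =>
    (degSum_le G T).trans (by rw [mul_comm]; exact Nat.mul_le_mul_right _ (by omega))
  by_cases hM : ConnOn G Sᶜ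
  · have hSd := degSum_le G S
    have hMd : degSum G Sᶜ + 10 ≤ 6 * Sᶜ.card := by
      by_contra! h
      have := (hM.exists_dominating hG (by omega) (by omega)).1
      omega
    -- For 1 ≤ s ≤ 6 the total s(s - 1) + 6(17 - s) - 10 is at most 86.
    generalize S.card = s at *
    interval_cases s <;> omega
  · unfold ConnOn at hM
    push Not at hM
    obtain ⟨S', hS'M, hne, hneM, hS'⟩ := hM
    have hdisj : Disjoint S S' := (disjoint_compl_right (a := S)).mono_right hS'M
    have hdisj' : Disjoint S (Sᶜ \ S') :=
      (disjoint_compl_right (a := S)).mono_right Finset.sdiff_subset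
    have hne' : (Sᶜ \ S').Nonempty := by
      rw [Finset.sdiff_nonempty]
      exact fun h => hneM (hS'M.antisymm h)
    have hM2 := no_edges_sdiff hS' hS'M
    have hc2 := Finset.card_sdiff_add_card_eq_card hS'M
    -- By maximality of `S`, its union with either remaining piece has at least 11 vertices, so all
    -- three pieces have at most six and the degree sum is at most 5 · 17 = 85.
    have c1 : 11 ≤ (S ∪ S').card := by
      have hcl : ∀ u ∈ S ∪ S', ∀ v, v ∉ S ∪ S' → ¬ G.Adj u v := by
        intro u hu v hv
        rw [Finset.mem_union, not_or] at hv
        rcases Finset.mem_union.1 hu with hu | hu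
        · exact hS u hu v hv.1
        · exact hS' u hu v (Finset.mem_compl.2 hv.1) hv.2
      refine (hclosed _ hcl).resolve_left fun h => ?_
      have := hmax _ ⟨hSne.mono Finset.subset_union_left, hcl, h⟩
      rw [Finset.card_union_of_disjoint hdisj] at this
      have := hne.card_pos
      omega
    have c2 : 11 ≤ (S ∪ (Sᶜ \ S')).card := by
      have hcl : ∀ u ∈ S ∪ (Sᶜ \ S'), ∀ v, v ∉ S ∪ (Sᶜ \ S') → ¬ G.Adj u v := by
        intro u hu v hv huv
        rw [Finset.mem_union, not_or, Finset.mem_sdiff, Finset.mem_compl] at hv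
        rcases Finset.mem_union.1 hu with hu | hu
        · exact hS u hu v hv.1 huv
        · rw [Finset.mem_sdiff] at hu
          exact hS' v (by tauto) u hu.1 hu.2 huv.symm
      refine (hclosed _ hcl).resolve_left fun h => ?_
      have := hmax _ ⟨hSne.mono Finset.subset_union_left, hcl, h⟩
      rw [Finset.card_union_of_disjoint hdisj'] at this
      have := hne'.card_pos
      omega
    rw [Finset.card_union_of_disjoint hdisj] at c1
    rw [Finset.card_union_of_disjoint hdisj'] at c2
    have f1 := five S hS6
    have f2 := five S' (by omega)
    have f3 := five (Sᶜ \ S') (by omega)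
    omega

end TwoColoredBipartite

/-! ### The three-colour count on 17 vertices. -/

theorem exists_monochromatic_path_nine (C : SimpleGraph.TopEdgeLabeling (Fin 17) (Fin 3)) :
    ∃ i : Fin 3, (SimpleGraph.pathGraph 9).IsContained (C.labelGraph i) := by
  by_contra hno
  set H : Fin 3 → SimpleGraph (Fin 17) := fun i => C.labelGraph i with hH
  have hfree : ∀ i, PathNineFree (H i) := fun i => pathNineFree_of_not_isContained (not_exists.1 hno i)
  have hex : ∀ u v, u ≠ v → ∃ i, (H i).Adj u v := fun u v huv =>
    ⟨C.get u v huv, SimpleGraph.TopEdgeLabeling.labelGraph_adj u v |>.2 ⟨huv, rfl⟩⟩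
  have huniq : ∀ i j u v, (H i).Adj u v → (H j).Adj u v → i = j := by
    intro i j u v hi hj
    obtain ⟨_, hi'⟩ := (SimpleGraph.TopEdgeLabeling.labelGraph_adj u v).1 hi
    obtain ⟨_, hj'⟩ := (SimpleGraph.TopEdgeLabeling.labelGraph_adj u v).1 hj
    exact hi'.symm.trans hj'
  have hcard : (Finset.univ : Finset (Fin 17)).card = 17 := by simp
  have hcut : ∀ i, ∀ S : Finset (Fin 17), 7 ≤ S.card → S.card ≤ 10 →
      ∃ u ∈ S, ∃ v, v ∉ S ∧ (H i).Adj u v := by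
    intro i S h7 h10
    by_contra! hS
    obtain ⟨j, k, hjk⟩ :=
      (by decide : ∀ i : Fin 3, ∃ j k : Fin 3, ∀ l, l = i ∨ l = j ∨ l = k) i
    refine false_of_balanced_cut (by simp) (hfree j) (hfree k) h7 h10 fun u hu v hv => ?_
    obtain ⟨l, hl⟩ := hex u v (by rintro rfl; exact hv hu)
    rcases hjk l with rfl | rfl | rfl
    exacts [absurd hl (hS u hu v hv), Or.inl hl, Or.inr hl]
  have hsum : 272 ≤ ∑ i, degSum (H i) Finset.univ := by
    unfold degSum
    rw [Finset.sum_comm]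
    have : ∀ u : Fin 17, 16 ≤ ∑ i, (nbrsIn (H i) Finset.univ u).card := by
      intro u
      have h1 : (Finset.univ.erase u).card = 16 := by
        rw [Finset.card_erase_of_mem (Finset.mem_univ u), hcard]
      rw [← h1]
      refine (Finset.card_le_card fun v hv => ?_).trans
        (Finset.card_biUnion_le (s := Finset.univ) (t := fun i => nbrsIn (H i) Finset.univ u))
      obtain ⟨i, hi⟩ := hex u v (Finset.mem_erase.1 hv).1.symm
      exact Finset.mem_biUnion.2 ⟨i, Finset.mem_univ _, mem_nbrsIn.2 ⟨Finset.mem_univ _, hi⟩⟩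
    calc 272 = ∑ _u : Fin 17, 16 := by simp
      _ ≤ _ := Finset.sum_le_sum fun u _ => this u
  have hconn : ∀ i, 90 ≤ degSum (H i) Finset.univ → ConnOn (H i) Finset.univ := fun i hi =>
    connOn_univ_of_degSum (by simp) (hfree i) (hcut i) hi
  -- Parity lifts 91 to 92 = 6 · 17 - 10, the extremal value.
  have hdom : ∀ i, 91 ≤ degSum (H i) Finset.univ →
      degSum (H i) Finset.univ = 92 ∧ ∃ a, ∀ v, v ≠ a → (H i).Adj v a := by
    intro i hi
    have heven := degSum_even (H i) Finset.univ
    rw [Nat.even_iff] at heven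
    obtain ⟨h1, a, -, ha⟩ := (hconn i (by omega)).exists_dominating (hfree i) (by omega) (by omega)
    exact ⟨by omega, a, fun v => ha v (Finset.mem_univ v)⟩
  -- Three sums of at most 90 total less than 272, so one is 92; the other two then total at least
  -- 180.
  obtain ⟨i, j, hij, hi, hj⟩ : ∃ i j, i ≠ j ∧ 91 ≤ degSum (H i) Finset.univ ∧
      90 ≤ degSum (H j) Finset.univ := by
    have d : ∀ i, 91 ≤ degSum (H i) Finset.univ → degSum (H i) Finset.univ = 92 :=
      fun i hi => (hdom i hi).1
    have d0 := d 0
    have d1 := d 1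
    have d2 := d 2
    rw [Fin.sum_univ_three] at hsum
    by_contra! h
    have h01 := h 0 1 (by decide)
    have h02 := h 0 2 (by decide)
    have h10 := h 1 0 (by decide)
    have h12 := h 1 2 (by decide)
    have h20 := h 2 0 (by decide)
    have h21 := h 2 1 (by decide)
    omega
  obtain ⟨-, a, ha⟩ := hdom i hi
  obtain ⟨u, hu, v, -, hv, huv⟩ := hconn j hj {a} (Finset.subset_univ _) (by simp)
    (fun h => by rw [← h] at hcard; simp at hcard)
  rw [Finset.mem_singleton] at hu hv
  subst hu
  exact hij (huniq i j u v (ha v hv).symm huv)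

theorem theorem8 :
    diagonalRamsey 3 (SimpleGraph.pathGraph 9) ≤ 17 ∧
      ∀ C : SimpleGraph.TopEdgeLabeling (Fin 17) (Fin 3),
        ∃ i : Fin 3, (SimpleGraph.pathGraph 9).IsContained (C.labelGraph i) :=
  ⟨iInf₂_le 17 exists_monochromatic_path_nine, exists_monochromatic_path_nine⟩
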